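/- Let $L^n$ be the affine variety of complex $n$-dimensional Lie algebras: its points are the alternating bilinear maps $\mu:\mathbb C^n\times\mathbb C^n\to\mathbb C^n$ satisfying the Jacobi identity, identified with their structure constants $(C_{ij}^k)\in\mathbb C^{n^3}$. The group $GL_n(\mathbb C)$ acts on $L^n$ by $(f*\mu)(X,Y)=f^{-1}(\mu(f(X),f(Y)))$. The Lie algebra $\mathfrak g=(\mathbb C^n,\mu)$ is called rigid if its orbit $\mathcal O(\mu)$ is Zariski open in $L^n$. A Robinson extension $\mathbb C^*$ of $\mathbb C$ is a non-Archimedean field extension of $\mathbb C$ to which all finitary functions and relations on $\mathbb C$ are extended so that the transfer principle holds (that is, $\mathbb C\subset\mathbb C^*$ is an elementary extension for the full language of $\mathbb C$, compatibly with the field operations, and $\mathbb C^*$ has elements that are bounded in modulus by no standard real number). Let $A\subset\mathbb C^*$ be the valuation ring of limited elements (those bounded in modulus by a standard real number) and $\mathfrak m$ its maximal ideal, the ideal of infinitesimals. A perturbation of $\mathfrak g$ is a Lie algebra $(A^n,\nu)$ over $A$ with $\nu(X,Y)-\mu(X,Y)\in\mathfrak m^n$ for all $X,Y\in\mathbb C^n$.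 A deformation ring is a valuation ring $B$ that is a $\mathbb C$-algebra with an augmentation $\varepsilon:B\to\mathbb C$ (so that its residue field is $\mathbb C$). A valued deformation of $\mathfrak g$ over $B$ is a Lie algebra $\mathfrak h$ over $B$ whose underlying $B$-module is free and such that $\mathbb C\otimes_B\mathfrak h\cong\mathfrak g$ as complex Lie algebras. Theorem. Let $\mathfrak g=(\mathbb C^n,\mu)$ be a complex Lie algebra of dimension $n$. (1) For every Robinson extension $\mathbb C^*$ of $\mathbb C$, $\mathfrak g$ is rigid if and only if every perturbation of $\mathfrak g$ in $\mathbb C^*$ is isomorphic to $\mathfrak g$ over $\mathbb C^*$, that is, $\mathbb C^*\otimes_A(A^n,\nu)\cong\mathbb C^*\otimes_{\mathbb C}\mathfrak g$ as Lie algebras over $\mathbb C^*$ for every perturbation $(A^n,\nu)$. Likewise, $\mathfrak g$ is rigid if and only if every perturbation of $\mathfrak g$ in $\mathbb C^*$ is isomorphic to $A\otimes_{\mathbb C}\mathfrak g$ as a Lie algebra over $A$. (2) $\mathfrak g$ is rigid if and only if, for every deformation ring $B$, every valued deformation $\mathfrak h$ of $\mathfrak g$ over $B$ is isomorphic to $\mathfrak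 g$ over an algebraic closure $\overline K$ of the fraction field $K$ of $B$, that is, $\overline K\otimes_B\mathfrak h\cong\overline K\otimes_{\mathbb C}\mathfrak g$ as Lie algebras over $\overline K$. -/

import Mathlib

open scoped TensorProduct

universe u v w

/-! ### Lie algebra products on `R^n` -/

/-- A Lie algebra product on the free module `R^n`: an alternating bilinear map
`R^n × R^n → R^n` which satisfies the Jacobi identity. For `R = ℂ` these are the points `μ` of the
variety `L^n` of complex `n`-dimensional Lie algebras. -/
@[ext]
structure LieProduct (R : Type*) [CommRing R] (n : ℕ) where
  bracket : (Fin n → R) →ₗ[R] (Fin n → R) →ₗ[R] (Fin n → R)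
  bracket_self : ∀ X, bracket X X = 0
  jacobi : ∀ X Y Z, bracket (bracket X Y) Z + bracket (bracket Y Z) X
    + bracket (bracket Z X) Y = 0

namespace LieProduct

section
variable {R : Type*} [CommRing R] {n : ℕ}

theorem bracket_skew (μ : LieProduct R n) (X Y : Fin n → R) :
    μ.bracket X Y = -μ.bracket Y X := by
  have h := μ.bracket_self (X + Y)
  simp only [map_add, LinearMap.add_apply, μ.bracket_self, zero_add, add_zero] at h
  exact eq_neg_of_add_eq_zero_right h

/-- The Lie algebra `(R^n, μ)`. -/
@[nolint unusedArguments]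
def Alg (_μ : LieProduct R n) : Type _ := Fin n → R

instance (μ : LieProduct R n) : AddCommGroup μ.Alg :=
  inferInstanceAs (AddCommGroup (Fin n → R))

instance (μ : LieProduct R n) : Module R μ.Alg :=
  inferInstanceAs (Module R (Fin n → R))

instance (μ : LieProduct R n) : LieRing μ.Alg where
  bracket X Y := μ.bracket X Y
  add_lie X Y Z := LinearMap.map_add₂ μ.bracket X Y Z
  lie_add X Y Z := (μ.bracket X).map_add Y Z
  lie_self X := μ.bracket_self X
  leibniz_lie X Y Z := by
    change μ.bracket X (μ.bracket Y Z) =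
      μ.bracket (μ.bracket X Y) Z + μ.bracket Y (μ.bracket X Z)
    have h := μ.jacobi X Y Z
    rw [μ.bracket_skew (μ.bracket Y Z) X, μ.bracket_skew (μ.bracket Z X) Y,
      μ.bracket_skew Z X, map_neg, neg_neg] at h
    rw [← sub_eq_zero, ← neg_eq_zero, ← h]
    abel

instance (μ : LieProduct R n) : LieAlgebra R μ.Alg where
  lie_smul t X Y := (μ.bracket X).map_smul t Y

/-- The structure constants `C_{ij}^k` of `μ`, given by `μ(e_i, e_j) = ∑ k, C_{ij}^k e_k`. -/
def structConst (μ : LieProduct R n) : Fin n × Fin n × Fin n → R :=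
  fun p => μ.bracket (Pi.single p.1 1) (Pi.single p.2.1 1) p.2.2

/-- The action of `f ∈ GL_n(R)` on Lie products: `(f * μ)(X, Y) = f⁻¹(μ(f X, f Y))`. -/
def act (f : (Fin n → R) ≃ₗ[R] (Fin n → R)) (μ : LieProduct R n) : LieProduct R n where
  bracket := (μ.bracket.compl₁₂ f.toLinearMap f.toLinearMap).compr₂ f.symm.toLinearMap
  bracket_self X := by simp [μ.bracket_self]
  jacobi X Y Z := by simp [← map_add, μ.jacobi]

/-- The orbit `O(μ)` of `μ` under the action of `GL_n(R)`. -/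
def orbit (μ : LieProduct R n) : Set (LieProduct R n) :=
  Set.range fun f : (Fin n → R) ≃ₗ[R] (Fin n → R) => act f μ

end

/-- A subset of `L^n` is Zariski open if it is the set of the points of `L^n` at which not all
the polynomials of some set of polynomials in the structure constants vanish. -/
def IsZariskiOpen {n : ℕ} (U : Set (LieProduct ℂ n)) : Prop :=
  ∃ S : Set (MvPolynomial (Fin n × Fin n × Fin n) ℂ),
    U = {μ | ∃ p ∈ S, MvPolynomial.eval μ.structConst p ≠ 0}

/-- The Lie algebra `(ℂ^n, μ)` is rigid if its orbit is Zariski open in `L^n`. -/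
def IsRigid {n : ℕ} (μ : LieProduct ℂ n) : Prop := IsZariskiOpen μ.orbit

end LieProduct

/-! ### Robinson extensions of `ℂ` -/

/-- The full first-order language of `ℂ`: a symbol for every finitary function on `ℂ` and for every
finitary relation on `ℂ`. -/
def fullLanguage : FirstOrder.Language.{0, 0} where
  Functions k := (Fin k → ℂ) → ℂ
  Relations k := Set (Fin k → ℂ)

/-- The symbol of a function. -/
def funSym {k : ℕ} (f : (Fin k → ℂ) → ℂ) : fullLanguage.Functions k := f

/-- The symbol of a relation. -/
def relSym {k : ℕ} (R : Set (Fin k → ℂ)) : fullLanguage.Relations k := R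

/-- Every symbol of the full language is interpreted in `ℂ` by itself. -/
instance : fullLanguage.Structure ℂ where
  funMap {k} (f : (Fin k → ℂ) → ℂ) x := f x
  RelMap {k} (R : Set (Fin k → ℂ)) x := x ∈ R

open FirstOrder in
/-- A (Robinson) nonstandard extension `F = ℂ*` of the field `ℂ`: every finitary function and every
finitary relation on `ℂ` is extended to `F`, in such a way that
the transfer principle holds (the inclusion `ℂ → F` is elementary for the full language of `ℂ`),
the extensions of the addition and the multiplication of `ℂ` are those of `F`, and `F` is
non-Archimedean: some element of `F` is not bounded by any standard real number. -/
class RobinsonExtension (F : Type*) [Field F] [Algebra ℂ F] extends fullLanguage.Structure F where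
  emb : ℂ ↪ₑ[fullLanguage] F
  emb_apply : ∀ z : ℂ, emb z = algebraMap ℂ F z
  funMap_add : ∀ x y : F, funMap (funSym fun v : Fin 2 → ℂ => v 0 + v 1) ![x, y] = x + y
  funMap_mul : ∀ x y : F, funMap (funSym fun v : Fin 2 → ℂ => v 0 * v 1) ![x, y] = x * y
  nonarchimedean : ∃ x : F, ∀ r : ℝ, ¬ RelMap (relSym {v : Fin 1 → ℂ | ‖v 0‖ ≤ r}) ![x]

namespace RobinsonExtension

open FirstOrder FirstOrder.Language FirstOrder.Language.Structure

variable {F : Type*} [Field F] [Algebra ℂ F] [RobinsonExtension F]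

theorem realize_univ {n : ℕ} (φ : fullLanguage.Formula (Fin n)) (M : Type*)
    [fullLanguage.Structure M] :
    M ⊨ ((φ.relabel Sum.inr : fullLanguage.Formula (Empty ⊕ Fin n)).iAlls (Fin n)) ↔
      ∀ v : Fin n → M, φ.Realize v := by
  rw [Sentence.Realize, Formula.realize_iAlls]
  refine forall_congr' fun v => ?_
  rw [Formula.realize_relabel]
  rfl

theorem transfer {n : ℕ} (φ : fullLanguage.Formula (Fin n))
    (h : ∀ v : Fin n → ℂ, φ.Realize v) (v : Fin n → F) : φ.Realize v :=
  (realize_univ φ F).1 (((emb (F := F)).map_sentence _).1 ((realize_univ φ ℂ).2 h)) v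

/-- `|x| ≤ r`, for `x` in the extension and a standard real number `r`. -/
def BoundedBy (r : ℝ) (x : F) : Prop :=
  RelMap (relSym {v : Fin 1 → ℂ | ‖v 0‖ ≤ r}) ![x]

/-- The formula `‖t‖ ≤ r`. -/
def leFormula (r : ℝ) {n : ℕ} (t : fullLanguage.Term (Fin n)) : fullLanguage.Formula (Fin n) :=
  (relSym {v : Fin 1 → ℂ | ‖v 0‖ ≤ r}).formula ![t]

theorem realize_leFormula (r : ℝ) {n : ℕ} (t : fullLanguage.Term (Fin n)) (v : Fin n → F) :
    (leFormula r t).Realize v ↔ BoundedBy r (t.realize v) := by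
  rw [leFormula, Formula.realize_rel, BoundedBy]
  refine iff_of_eq (congrArg _ (funext fun i => ?_))
  fin_cases i; rfl

theorem realize_leFormula_complex (r : ℝ) {n : ℕ} (t : fullLanguage.Term (Fin n))
    (v : Fin n → ℂ) : (leFormula r t).Realize v ↔ ‖t.realize v‖ ≤ r := by
  rw [leFormula, Formula.realize_rel]
  rfl

/-- The term `x + y`. -/
def addTerm : fullLanguage.Term (Fin 2) :=
  (funSym fun v : Fin 2 → ℂ => v 0 + v 1).apply₂ (Term.var 0) (Term.var 1)

/-- The term `x * y`. -/
def mulTerm : fullLanguage.Term (Fin 2) :=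
  (funSym fun v : Fin 2 → ℂ => v 0 * v 1).apply₂ (Term.var 0) (Term.var 1)

theorem realize_addTerm (x y : F) : addTerm.realize ![x, y] = x + y := by
  rw [addTerm, Term.realize_functions_apply₂]
  exact funMap_add x y

theorem realize_mulTerm (x y : F) : mulTerm.realize ![x, y] = x * y := by
  rw [mulTerm, Term.realize_functions_apply₂]
  exact funMap_mul x y

theorem realize_addTerm_complex (v : Fin 2 → ℂ) : addTerm.realize v = v 0 + v 1 := by
  rw [addTerm, Term.realize_functions_apply₂]
  rfl

theorem realize_mulTerm_complex (v : Fin 2 → ℂ) : mulTerm.realize v = v 0 * v 1 := by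
  rw [mulTerm, Term.realize_functions_apply₂]
  rfl

theorem BoundedBy.add {r s : ℝ} {x y : F} (hx : BoundedBy r x) (hy : BoundedBy s y) :
    BoundedBy (r + s) (x + y) := by
  have h := transfer (F := F)
    ((leFormula r (Term.var 0)).imp ((leFormula s (Term.var 1)).imp (leFormula (r + s) addTerm)))
    (fun v => by
      simp only [Formula.realize_imp, realize_leFormula_complex, realize_addTerm_complex,
        Term.realize_var]
      exact fun h0 h1 => (norm_add_le _ _).trans (add_le_add h0 h1)) ![x, y]
  simp only [Formula.realize_imp, realize_leFormula, realize_addTerm] at h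
  exact h hx hy

theorem BoundedBy.mul {r s : ℝ} {x y : F} (hx : BoundedBy r x) (hy : BoundedBy s y) :
    BoundedBy (r * s) (x * y) := by
  have h := transfer (F := F)
    ((leFormula r (Term.var 0)).imp ((leFormula s (Term.var 1)).imp (leFormula (r * s) mulTerm)))
    (fun v => by
      simp only [Formula.realize_imp, realize_leFormula_complex, realize_mulTerm_complex,
        Term.realize_var]
      intro h0 h1
      rw [norm_mul]
      exact mul_le_mul h0 h1 (norm_nonneg _) ((norm_nonneg _).trans h0)) ![x, y]
  simp only [Formula.realize_imp, realize_leFormula, realize_mulTerm] at h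
  exact h hx hy

theorem boundedBy_algebraMap (z : ℂ) : BoundedBy ‖z‖ (algebraMap ℂ F z) := by
  have h := ((emb (F := F)).map_formula (leFormula ‖z‖ (Term.var (0 : Fin 1))) ![z]).2
    ((realize_leFormula_complex _ _ _).2 le_rfl)
  rw [realize_leFormula] at h
  rw [← emb_apply]
  exact h

theorem boundedBy_one_of_mul_eq_one {x y : F} (h : x * y = 1) :
    BoundedBy 1 x ∨ BoundedBy 1 y := by
  have h1 := transfer (F := F)
    (∼(leFormula 1 (Term.var 0)) ⟹ (∼(leFormula 1 (Term.var 1)) ⟹ ∼(leFormula 1 mulTerm)))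
    (fun v => by
      simp only [Formula.realize_imp, Formula.realize_not, realize_leFormula_complex,
        realize_mulTerm_complex, Term.realize_var, not_le]
      intro h0 h1
      rw [norm_mul]
      nlinarith) ![x, y]
  simp only [Formula.realize_imp, Formula.realize_not, realize_leFormula, realize_mulTerm, h] at h1
  have h2 : BoundedBy 1 (1 : F) := by simpa using boundedBy_algebraMap (F := F) 1
  by_contra! hc
  exact h1 hc.1 hc.2 h2

variable (F) in
/-- The valuation ring `A` of the limited elements of a Robinson extension `F = ℂ*`, that is, of
those which are bounded in modulus by a standard real number. -/
def limited : ValuationSubring F where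
  carrier := {x | ∃ r : ℝ, BoundedBy r x}
  mul_mem' := fun ⟨_, hx⟩ ⟨_, hy⟩ => ⟨_, hx.mul hy⟩
  one_mem' := ⟨_, by simpa using boundedBy_algebraMap (F := F) 1⟩
  add_mem' := fun ⟨_, hx⟩ ⟨_, hy⟩ => ⟨_, hx.add hy⟩
  zero_mem' := ⟨_, by simpa using boundedBy_algebraMap (F := F) 0⟩
  neg_mem' := fun ⟨_, hx⟩ =>
    ⟨_, by simpa using (boundedBy_algebraMap (F := F) (-1)).mul hx⟩
  mem_or_inv_mem' x := by
    by_cases hx : x = 0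
    · exact Or.inl ⟨_, by simpa [hx] using boundedBy_algebraMap (F := F) 0⟩
    · exact (boundedBy_one_of_mul_eq_one (mul_inv_cancel₀ hx)).imp (fun h => ⟨_, h⟩)
        (fun h => ⟨_, h⟩)

/-- Standard complex numbers are limited, so that `A` is an algebra over `ℂ`. -/
instance : Algebra ℂ (limited F) :=
  RingHom.toAlgebra
    { toFun := fun z => ⟨algebraMap ℂ F z, _, boundedBy_algebraMap z⟩
      map_one' := Subtype.ext (map_one _)
      map_mul' := fun _ _ => Subtype.ext (map_mul _ _ _)
      map_zero' := Subtype.ext (map_zero _)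
      map_add' := fun _ _ => Subtype.ext (map_add _ _ _) }

instance : IsScalarTower ℂ (limited F) F := IsScalarTower.of_algebraMap_eq fun _ => rfl

end RobinsonExtension

/-! ### Deformations -/

namespace LieProduct

variable {n : ℕ}

/-- A perturbation of `μ` in the Robinson extension `F` of `ℂ`: a Lie product `ν` on `A^n`, where
`A` is the ring of the limited elements of `F` and `𝔪` its maximal ideal, the ideal of the
infinitesimals, such that `ν(X, Y) - μ(X, Y) ∈ 𝔪^n` for all `X, Y ∈ ℂ^n`. In particular the reduction
of `ν` modulo `𝔪` is `μ`. -/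
def IsPerturbation {F : Type*} [Field F] [Algebra ℂ F] [RobinsonExtension F]
    (μ : LieProduct ℂ n) (ν : LieProduct (RobinsonExtension.limited F) n) : Prop :=
  ∀ (X Y : Fin n → ℂ) (k : Fin n),
    ν.bracket (fun i => algebraMap ℂ _ (X i)) (fun i => algebraMap ℂ _ (Y i)) k
      - algebraMap ℂ _ (μ.bracket X Y k)
      ∈ IsLocalRing.maximalIdeal (RobinsonExtension.limited F)

end LieProduct

/-- Let `B` be a commutative `ℂ`-algebra with an augmentation `ε : B → ℂ`, and `g` a complex Lie
algebra. A Lie algebra `h` over `B` is a `B`-deformation of `g` if its underlying `B`-module is free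
and the complex Lie algebra `ℂ ⊗_B h`, formed along `ε`, is isomorphic to `g`. -/
def IsDeformation {B : Type*} [CommRing B] [Algebra ℂ B] (ε : B →ₐ[ℂ] ℂ)
    (g : Type*) [LieRing g] [LieAlgebra ℂ g] (h : Type*) [LieRing h] [LieAlgebra B h] : Prop :=
  letI : Algebra B ℂ := ε.toRingHom.toAlgebra
  Module.Free B h ∧ Nonempty ((ℂ ⊗[B] h) ≃ₗ⁅ℂ⁆ g)

/-! ### Lie algebras and their isomorphisms in terms of structure constants. -/

section StructureConstants

variable {n : ℕ} {R : Type*} [CommRing R]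

/-! Everything is expressed in structure constants: an isomorphism is a pair of mutually inverse
matrices subject to polynomial equations (`nonempty_lieEquiv_iff`). In the spectrum of ℂ[C_ij^k] the
Lie laws form a closed set `lieLocus`, and the orbit of μ a set `isoLocus`, constructible by
Chevalley's theorem.

Suppose μ is rigid. Each point of the orbit has a polynomial p, nonzero there, such that every
complex Lie law with p ≠ 0 is in the orbit. By constructibility and the Nullstellensatz this
persists over every algebraically closed extension of ℂ (`isoSC_of_aeval_ne_zero`). A valued
deformation reduces to a point of the orbit, so a suitable p does not vanish on its structure
constants, and it is isomorphic to μ over the algebraic closure. For perturbations an isomorphism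
over A is found directly, which requires limited matrices: Baire's theorem and homogeneity show that
the Lie laws near μ are isomorphic to it by uniformly bounded matrices
(`eventually_mem_boundedOrbit`). Such matrices, chosen as functions of the structure constants,
extend to ℂ* and are evaluated at ν (`isoSC_of_isPerturbation`).

Suppose μ is not rigid. Then μ lies in the closure of the constructible set of Lie laws outside the
orbit, hence on an irreducible variety of which a nonempty open part avoids the orbit
(`exists_generic_nonorbit`). The main point, `exists_algHom_specialization`, produces a B-point of
this open part which reduces to μ. Noether normalization maps the variety to an affine space, where
one moves along a line with parameter t in the prime J. This path lifts to B, which is integrally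
closed in an algebraically closed field, and a Galois automorphism corrects the lift so that it
reduces to μ and not to another point of the same fibre. This applies to A, because ℂ* is
algebraically closed, and to a valuation ring of the algebraic closure of ℂ(X). -/

/-- The left-hand sides of the equations which say that a family of structure constants defines
a Lie algebra. -/
def lieRel (r : (Fin n × Fin n) ⊕ (Fin n × Fin n × Fin n) ⊕ (Fin n × Fin n × Fin n × Fin n))
    (c : Fin n × Fin n × Fin n → R) : R :=
  match r with
  | .inl (i, k) => c (i, i, k)
  | .inr (.inl (i, j, k)) => c (i, j, k) + c (j, i, k)
  | .inr (.inr (i, j, k, m)) =>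
    ∑ l, (c (i, j, l) * c (l, k, m) + c (j, k, l) * c (l, i, m) + c (k, i, l) * c (l, j, m))

/-- `c` is a family of structure constants of a Lie algebra. -/
def IsLieSC (c : Fin n × Fin n × Fin n → R) : Prop := ∀ r, lieRel r c = 0

/-- The Lie algebras with structure constants `c` and `d` are isomorphic. -/
def IsoSC (c d : Fin n × Fin n × Fin n → R) : Prop :=
  ∃ f g : Matrix (Fin n) (Fin n) R, f * g = 1 ∧ g * f = 1 ∧
    ∀ i j k, ∑ l, c (i, j, l) * f k l = ∑ a, ∑ b, f a i * f b j * d (a, b, k)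

theorem map_lieRel {S : Type*} [CommRing S] (φ : R →+* S) (r) (c : Fin n × Fin n × Fin n → R) :
    φ (lieRel r c) = lieRel r (φ ∘ c) := by
  rcases r with r | r | r <;> simp [lieRel]

theorem IsLieSC.map {S : Type*} [CommRing S] (φ : R →+* S) {c : Fin n × Fin n × Fin n → R}
    (h : IsLieSC c) : IsLieSC (φ ∘ c) := fun r => by
  rw [← map_lieRel, h r, map_zero]

theorem IsoSC.refl (c : Fin n × Fin n × Fin n → R) : IsoSC c c :=
  ⟨1, 1, one_mul 1, one_mul 1, fun i j k => by simp [Matrix.one_apply]⟩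

theorem IsoSC.map {S : Type*} [CommRing S] (φ : R →+* S) {c d : Fin n × Fin n × Fin n → R}
    (h : IsoSC c d) : IsoSC (φ ∘ c) (φ ∘ d) := by
  obtain ⟨f, g, hfg, hgf, h⟩ := h
  refine ⟨φ.mapMatrix f, φ.mapMatrix g, by rw [← map_mul, hfg, map_one],
    by rw [← map_mul, hgf, map_one], fun i j k => ?_⟩
  have := congrArg φ (h i j k)
  simpa using this

/-- The structure constants of a Lie algebra in a basis. -/
noncomputable def basisSC {L : Type*} [LieRing L] [LieAlgebra R L] (b : Module.Basis (Fin n) R L) :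
    Fin n × Fin n × Fin n → R := fun p => b.repr ⁅b p.1, b p.2.1⁆ p.2.2

section Basis

variable {L M : Type*} [LieRing L] [LieAlgebra R L] [LieRing M] [LieAlgebra R M]

theorem bracket_eq_sum_basisSC (b : Module.Basis (Fin n) R L) (i j : Fin n) :
    ⁅b i, b j⁆ = ∑ l, basisSC b (i, j, l) • b l := (b.sum_repr _).symm

theorem repr_lie_eq (b : Module.Basis (Fin n) R L) (x y : L) (k : Fin n) :
    b.repr ⁅x, y⁆ k = ∑ i, ∑ j, b.repr x i * b.repr y j * basisSC b (i, j, k) := by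
  conv_lhs => rw [← b.sum_repr x, ← b.sum_repr y]
  simp only [sum_lie, lie_sum, smul_lie, lie_smul, map_sum, map_smul,
    Finsupp.coe_finsetSum, Finset.sum_apply, Finsupp.smul_apply, smul_eq_mul, basisSC, mul_assoc,
    Finset.mul_sum]
  rw [Finset.sum_comm]
  exact Finset.sum_congr rfl fun i _ => Finset.sum_congr rfl fun j _ => mul_left_comm _ _ _

theorem isoSC_of_lieEquiv (b : Module.Basis (Fin n) R L) (b' : Module.Basis (Fin n) R M)
    (e : L ≃ₗ⁅R⁆ M) : IsoSC (basisSC b) (basisSC b') := by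
  refine ⟨LinearMap.toMatrix b b' e.toLinearEquiv, LinearMap.toMatrix b' b e.toLinearEquiv.symm,
    ?_, ?_, fun i j k => ?_⟩
  · rw [← LinearMap.toMatrix_comp, LinearEquiv.comp_coe]; simp
  · rw [← LinearMap.toMatrix_comp, LinearEquiv.comp_coe]; simp
  · have h : b'.repr (e ⁅b i, b j⁆) k = b'.repr ⁅e (b i), e (b j)⁆ k := by rw [LieEquiv.map_lie]
    rw [repr_lie_eq, bracket_eq_sum_basisSC] at h
    simpa [LinearMap.toMatrix_apply] using h

theorem lieEquiv_of_isoSC (b : Module.Basis (Fin n) R L) (b' : Module.Basis (Fin n) R M)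
    (h : IsoSC (basisSC b) (basisSC b')) : Nonempty (L ≃ₗ⁅R⁆ M) := by
  obtain ⟨f, g, hfg, hgf, h⟩ := h
  let e : L ≃ₗ[R] M := LinearEquiv.ofLinearMap (Matrix.toLin b b' f) (Matrix.toLin b' b g)
    (by rw [← Matrix.toLin_mul, hfg, Matrix.toLin_one])
    (by rw [← Matrix.toLin_mul, hgf, Matrix.toLin_one])
  have he : ∀ i k, b'.repr (e (b i)) k = f k i := fun i k => by
    change b'.repr (Matrix.toLin b b' f (b i)) k = _
    rw [Matrix.toLin_self]
    simp [Finsupp.single_apply]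
  have key : (LieModule.toEnd R L L : L →ₗ[R] L →ₗ[R] L).compr₂ e.toLinearMap =
      (LieModule.toEnd R M M : M →ₗ[R] M →ₗ[R] M).compl₁₂ e.toLinearMap e.toLinearMap := by
    refine b.ext fun i => b.ext fun j => b'.ext_elem fun k => ?_
    simp only [LinearMap.compr₂_apply, LinearMap.compl₁₂_apply, LieHom.coe_toLinearMap,
      LieModule.toEnd_apply_apply, LinearEquiv.coe_coe]
    rw [repr_lie_eq, bracket_eq_sum_basisSC]
    simp only [map_sum, map_smul, Finsupp.coe_finsetSum, Finset.sum_apply, Finsupp.smul_apply,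
      he, smul_eq_mul]
    exact h i j k
  exact ⟨{ e with
    map_lie' := fun {x y} => by
      have := LinearMap.congr_fun (LinearMap.congr_fun key x) y
      simpa using this }⟩

/-- The bridge through which every isomorphism in the theorem becomes a system of polynomial
equations. -/
theorem nonempty_lieEquiv_iff (b : Module.Basis (Fin n) R L) (b' : Module.Basis (Fin n) R M) :
    Nonempty (L ≃ₗ⁅R⁆ M) ↔ IsoSC (basisSC b) (basisSC b') :=
  ⟨fun ⟨e⟩ => isoSC_of_lieEquiv b b' e, lieEquiv_of_isoSC b b'⟩

theorem basisSC_baseChange (S : Type*) [CommRing S] [Algebra R S]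
    (b : Module.Basis (Fin n) R L) :
    basisSC (b.baseChange S) = algebraMap R S ∘ basisSC b := by
  funext p
  simp [basisSC, LieAlgebra.ExtendScalars.bracket_tmul, Algebra.smul_def]

theorem basisSC_isLieSC (b : Module.Basis (Fin n) R L) : IsLieSC (basisSC b) := by
  rintro (⟨i, k⟩ | ⟨i, j, k⟩ | ⟨i, j, k, m⟩)
  · simp [lieRel, basisSC]
  · have : ⁅b i, b j⁆ + ⁅b j, b i⁆ = 0 := by rw [← lie_skew, neg_add_cancel]
    have := congrArg (fun x => b.repr x k) this
    simpa [lieRel, basisSC] using this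
  · have h3 : ∀ i j k, b.repr ⁅⁅b i, b j⁆, b k⁆ m
        = ∑ l, basisSC b (i, j, l) * basisSC b (l, k, m) := fun i j k => by
      rw [bracket_eq_sum_basisSC b i j, sum_lie]
      simp only [smul_lie, map_sum, map_smul, Finsupp.coe_finsetSum, Finset.sum_apply,
        Finsupp.smul_apply, smul_eq_mul, basisSC]
    have h4 : ⁅⁅b i, b j⁆, b k⁆ + ⁅⁅b j, b k⁆, b i⁆ + ⁅⁅b k, b i⁆, b j⁆ = 0 := by
      have h := lie_jacobi (b i) (b j) (b k)
      rw [← lie_skew (b i) ⁅b j, b k⁆, ← lie_skew (b j) ⁅b k, b i⁆,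
        ← lie_skew (b k) ⁅b i, b j⁆, ← neg_add, ← neg_add, neg_eq_zero] at h
      rw [← h]
      abel
    simp only [lieRel, Finset.sum_add_distrib, ← h3]
    simpa only [map_add, Finsupp.add_apply, map_zero, Finsupp.zero_apply] using
      congrArg (fun x => b.repr x m) h4

end Basis

namespace LieProduct

/-- The standard basis of `(R^n, μ)`. -/
noncomputable def stdBasis (μ : LieProduct R n) : Module.Basis (Fin n) R μ.Alg :=
  (Pi.basisFun R (Fin n) : Module.Basis (Fin n) R (Fin n → R))

theorem basisSC_stdBasis (μ : LieProduct R n) : basisSC μ.stdBasis = μ.structConst := by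
  funext p
  change (Pi.basisFun R (Fin n)).repr (μ.bracket (Pi.basisFun R (Fin n) p.1)
    (Pi.basisFun R (Fin n) p.2.1)) p.2.2 = _
  simp [structConst]

theorem isLieSC_structConst (μ : LieProduct R n) : IsLieSC μ.structConst :=
  μ.basisSC_stdBasis ▸ basisSC_isLieSC _

theorem bracket_apply (μ : LieProduct R n) (X Y : Fin n → R) (k : Fin n) :
    μ.bracket X Y k = ∑ i, ∑ j, X i * Y j * μ.structConst (i, j, k) := by
  rw [← basisSC_stdBasis]
  exact repr_lie_eq μ.stdBasis X Y k

/-- The Lie product with given structure constants. -/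
noncomputable def ofStructConst (c : Fin n × Fin n × Fin n → R) (hc : IsLieSC c) :
    LieProduct R n :=
  let m : (Fin n → R) →ₗ[R] (Fin n → R) →ₗ[R] (Fin n → R) :=
    LinearMap.mk₂ R (fun X Y k => ∑ i, ∑ j, X i * Y j * c (i, j, k))
      (fun X X' Y => by ext; simp [add_mul, Finset.sum_add_distrib])
      (fun t X Y => by ext; simp [Finset.mul_sum, mul_assoc])
      (fun X Y Y' => by ext; simp [add_mul, mul_add, Finset.sum_add_distrib])
      (fun t X Y => by ext; simp [Finset.mul_sum, mul_assoc, mul_left_comm])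
  have hm : ∀ X Y k, m X Y k = ∑ i, ∑ j, X i * Y j * c (i, j, k) := fun _ _ _ => rfl
  have e2 : ∀ i j l, m (Pi.single i 1) (Pi.single j 1) l = c (i, j, l) := fun i j l => by
    simp [hm, Pi.single_apply]
  have skew : ∀ X Y, m X Y = -m Y X := by
    have h : m = -m.flip := by
      refine (Pi.basisFun R (Fin n)).ext fun i => (Pi.basisFun R (Fin n)).ext fun j =>
        funext fun k => eq_neg_of_add_eq_zero_left ?_
      simp only [Pi.basisFun_apply, LinearMap.flip_apply, e2]
      exact hc (.inr (.inl (i, j, k)))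
    exact fun X Y => LinearMap.congr_fun (LinearMap.congr_fun h X) Y
  have jac : ∀ X Y Z, m (m X Y) Z + m (m Y Z) X + m (m Z X) Y = 0 := by
    have lin : ∀ Y Z, (∀ i, m (m (Pi.single i 1) Y) Z + m (m Y Z) (Pi.single i 1)
        + m (m Z (Pi.single i 1)) Y = 0) → ∀ X, m (m X Y) Z + m (m Y Z) X + m (m Z X) Y = 0 := by
      intro Y Z h X
      have h0 : (m.flip Z).comp (m.flip Y) + m (m Y Z) + (m.flip Y).comp (m Z) = 0 :=
        (Pi.basisFun R (Fin n)).ext fun i => by simpa using h i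
      simpa using LinearMap.congr_fun h0 X
    -- The Jacobi sum is invariant under cyclic rotation, so `lin` used three times with rotations
    -- in between reduces the identity to basis vectors.
    have rot : ∀ X Y Z, m (m X Y) Z + m (m Y Z) X + m (m Z X) Y = 0 →
        m (m Z X) Y + m (m X Y) Z + m (m Y Z) X = 0 := fun X Y Z h => by rw [← h]; abel
    have e3 : ∀ i j k, m (m (Pi.single i 1) (Pi.single j 1)) (Pi.single k 1)
        = fun p => ∑ l, c (i, j, l) * c (l, k, p) := fun i j k => funext fun p => by
      rw [hm]
      simp [e2, Pi.single_apply]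
    refine fun X Y Z => lin Y Z (fun i => rot _ _ _ (lin Z _ (fun j => rot _ _ _ (lin _ _
      (fun k => funext fun p => ?_) Z)) Y)) X
    have h := hc (.inr (.inr (k, i, j, p)))
    simp only [lieRel, Finset.sum_add_distrib] at h
    rw [e3, e3, e3]
    exact h
  { bracket := m
    bracket_self := fun X => by
      -- Skew symmetry does not imply alternation when 2 is a zero divisor. The diagonal relations
      -- handle the squares of basis vectors, and skew symmetry cancels the cross terms.
      have h : ∀ s : Finset (Fin n), m (∑ i ∈ s, X i • Pi.single i 1)
          (∑ i ∈ s, X i • Pi.single i 1) = 0 := fun s => by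
        induction s using Finset.induction_on with
        | empty => simp
        | insert a s ha ih =>
          have h1 : m (Pi.single a 1) (Pi.single a 1) = 0 := funext fun k => by
            rw [e2]; exact hc (.inl (a, k))
          rw [Finset.sum_insert ha, map_add, map_add, LinearMap.add_apply, LinearMap.add_apply, ih,
            skew (X a • Pi.single a 1) (∑ i ∈ s, _)]
          simp [h1]
      have hX : ∑ i, X i • (Pi.single i 1 : Fin n → R) = X := by
        simpa using (Pi.basisFun R (Fin n)).sum_repr X
      simpa only [hX] using h Finset.univ
    jacobi := jac }

theorem structConst_ofStructConst (c : Fin n × Fin n × Fin n → R) (hc : IsLieSC c) :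
    (ofStructConst c hc).structConst = c := by
  funext p
  change ∑ i : Fin n, ∑ j : Fin n, (Pi.single p.1 1 : Fin n → R) i *
    (Pi.single p.2.1 1 : Fin n → R) j * c (i, j, p.2.2) = c p
  simp [Pi.single_apply]

theorem mem_orbit_iff_lieEquiv {lam μ : LieProduct R n} :
    lam ∈ μ.orbit ↔ Nonempty (lam.Alg ≃ₗ⁅R⁆ μ.Alg) := by
  constructor
  · rintro ⟨f, rfl⟩
    exact ⟨{ f with map_lie' := fun {X Y} => f.apply_symm_apply (μ.bracket (f X) (f Y)) }⟩
  · rintro ⟨e⟩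
    let f : (Fin n → R) ≃ₗ[R] (Fin n → R) := e.toLinearEquiv
    refine ⟨f, ?_⟩
    ext1
    refine LinearMap.ext fun X => LinearMap.ext fun Y => ?_
    change f.symm (μ.bracket (f X) (f Y)) = _
    rw [LinearEquiv.symm_apply_eq]
    exact (e.map_lie X Y).symm

theorem mem_orbit_iff {lam μ : LieProduct R n} :
    lam ∈ μ.orbit ↔ IsoSC lam.structConst μ.structConst := by
  rw [mem_orbit_iff_lieEquiv, nonempty_lieEquiv_iff lam.stdBasis μ.stdBasis, basisSC_stdBasis,
    basisSC_stdBasis]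

end LieProduct

end StructureConstants

/-! ### Lifting points of complex varieties to valuation rings. -/

section Lifting

/-- A ring homomorphism to an algebraically closed field extends along an injective integral
extension of domains. -/
theorem exists_extend_of_isIntegral {P S K : Type*} [CommRing P] [CommRing S] [IsDomain S]
    [Algebra P S] [FaithfulSMul P S] [Algebra.IsIntegral P S] [Field K] [IsAlgClosed K]
    (y : P →+* K) : ∃ θ : S →+* K, θ.comp (algebraMap P S) = y := by
  have := RingHom.ker_isPrime y
  -- By lying over, S/Q is an integral extension of P/ker y, which embeds in K. Algebraic closedness
  -- extends this embedding.
  obtain ⟨Q, hQ, hQP⟩ := Ideal.exists_ideal_over_prime_of_isIntegral_of_isDomain (S := S)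
    (RingHom.ker y) (by
      rw [(RingHom.injective_iff_ker_eq_bot _).1 (FaithfulSMul.algebraMap_injective P S)]
      exact bot_le)
  have : Q.LiesOver (RingHom.ker y) := ⟨hQP.symm⟩
  let : Algebra (P ⧸ RingHom.ker y) K := (RingHom.kerLift y).toAlgebra
  have h1 : FaithfulSMul (P ⧸ RingHom.ker y) K :=
    (faithfulSMul_iff_algebraMap_injective _ _).2 (RingHom.kerLift_injective y)
  have h2 : FaithfulSMul (P ⧸ RingHom.ker y) (S ⧸ Q) := inferInstance
  have h3 : Algebra.IsIntegral (P ⧸ RingHom.ker y) (S ⧸ Q) := inferInstance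
  have h4 : Module.IsTorsionFree (P ⧸ RingHom.ker y) (S ⧸ Q) :=
    Module.isTorsionFree_iff_faithfulSMul.2 h2
  let θ : (S ⧸ Q) →ₐ[P ⧸ RingHom.ker y] K := IsAlgClosed.lift
  refine ⟨θ.toRingHom.comp (Ideal.Quotient.mk Q), RingHom.ext fun p => ?_⟩
  have := θ.commutes (Ideal.Quotient.mk _ p)
  exact this

/-- A finite extension `R` of a normal domain `P` of characteristic zero embeds over `P` into an
integral extension whose automorphisms over `P` permute transitively the primes over any prime
of `P`. -/
theorem exists_integral_extension_transitive {P : Type u} {R : Type v} [CommRing P] [IsDomain P]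
    [CharZero P] [IsIntegrallyClosed P] [CommRing R] [IsDomain R] [Algebra P R] [FaithfulSMul P R]
    [Module.Finite P R] :
    ∃ (S : Type v) (_ : CommRing S) (_ : IsDomain S) (_ : Algebra P S) (_ : FaithfulSMul P S)
      (_ : Algebra.IsIntegral P S) (j : R →ₐ[P] S), Function.Injective j ∧
      ∀ Q Q' : Ideal S, Q.IsPrime → Q'.IsPrime → Q.under P = Q'.under P →
        ∃ σ : S ≃ₐ[P] S, Q'.comap σ = Q := by
  let K := FractionRing P
  let L := FractionRing R
  have : CharZero K := charZero_of_injective_algebraMap (IsFractionRing.injective P K)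
  let : Algebra K L := FractionRing.liftAlgebra P L
  have : IsScalarTower P K L := FractionRing.isScalarTower_liftAlgebra P L
  have : FiniteDimensional K L := .of_isLocalization P R (nonZeroDivisors P)
  have : Algebra.IsAlgebraic K (AlgebraicClosure L) := .trans K L _
  have : IsAlgClosure K (AlgebraicClosure L) := ⟨inferInstance, inferInstance⟩
  let E := IntermediateField.normalClosure K L (AlgebraicClosure L)
  -- Normality comes from the normal closure, separability from characteristic zero.
  have : IsGalois K E := { }
  let : Algebra P E := ((algebraMap K E).comp (algebraMap P K)).toAlgebra
  have : IsScalarTower P K E := .of_algebraMap_eq fun _ => rfl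
  have : FaithfulSMul P E := (faithfulSMul_iff_algebraMap_injective _ _).2
    ((algebraMap K E).injective.comp (IsFractionRing.injective P K))
  let S := integralClosure P E
  have : IsFractionRing S E := integralClosure.isFractionRing_of_finite_extension K E
  have hfin : Finite (S ≃ₐ[P] S) := Finite.of_equiv _ (galRestrict P K E S).toEquiv
  have := Algebra.isInvariant_of_isGalois' P K E S
  let jE : R →ₐ[P] E :=
    { (algebraMap L E).comp (algebraMap R L) with
      commutes' := fun p => by
        change algebraMap L E (algebraMap R L (algebraMap P R p)) = algebraMap K E (algebraMap P K p)
        rw [← IsScalarTower.algebraMap_apply P R L, IsScalarTower.algebraMap_apply P K L,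
          ← IsScalarTower.algebraMap_apply K L E] }
  have hjE : Function.Injective jE :=
    (algebraMap L E).injective.comp (IsFractionRing.injective R L)
  refine ⟨S, inferInstance, inferInstance, inferInstance, inferInstance, inferInstance,
    jE.codRestrict S fun r => (Algebra.IsIntegral.isIntegral (R := P) r).map jE,
    fun a b h => hjE (congrArg Subtype.val h), fun Q Q' hQ hQ' h => ?_⟩
  obtain ⟨g, hg⟩ := Algebra.IsInvariant.exists_smul_of_under_eq P S (S ≃ₐ[P] S) Q Q' h
  refine ⟨g, ?_⟩
  rw [hg]
  ext x
  rw [Ideal.mem_comap]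
  exact Ideal.smul_mem_pointwise_smul_iff

/-- Write h = X^k h₁ with h₁(0) ≠ 0. Then h₁(t) is congruent modulo J to the nonzero constant h₁(0),
a unit, so it is not even in J. -/
theorem aeval_ne_zero_of_mem {B : Type*} [CommRing B] [IsDomain B] [Algebra ℂ B] {J : Ideal B}
    [J.IsPrime] {t : B} (ht : t ∈ J) (ht0 : t ≠ 0) {h : Polynomial ℂ} (hh : h ≠ 0) :
    Polynomial.aeval t h ≠ 0 := by
  obtain ⟨h₁, h₂, h₃⟩ := Polynomial.exists_eq_pow_rootMultiplicity_mul_and_not_dvd h hh 0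
  rw [h₂, map_mul, map_pow]
  simp only [map_zero, sub_zero, Polynomial.aeval_X] at h₃ ⊢
  refine mul_ne_zero (pow_ne_zero _ ht0) fun h0 => ?_
  rw [Polynomial.X_dvd_iff] at h₃
  have h4 : Polynomial.aeval t h₁ =
      t * Polynomial.aeval t h₁.divX + algebraMap ℂ B (h₁.coeff 0) := by
    conv_lhs => rw [← Polynomial.X_mul_divX_add h₁]
    simp only [map_add, map_mul, Polynomial.aeval_X, Polynomial.aeval_C]
  rw [h0] at h4
  have h5 : algebraMap ℂ B (h₁.coeff 0) ∈ J := by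
    rw [eq_neg_of_add_eq_zero_right h4.symm]
    exact J.neg_mem (J.mul_mem_right _ ht)
  exact Ideal.IsPrime.ne_top' (J.eq_top_of_isUnit_mem h5 ((IsUnit.mk0 _ h₃).map _))

/-- The values of θ are integral over the image of y, hence over B, hence in B. -/
theorem exists_codRestrict_of_isIntegral {P S B K : Type*} [CommRing P] [CommRing S]
    [Algebra P S] [Algebra.IsIntegral P S] [CommRing B] [CommRing K] [Algebra B K]
    [FaithfulSMul B K] [IsIntegrallyClosedIn B K] (y : P →+* B) (θ : S →+* K)
    (h : θ.comp (algebraMap P S) = (algebraMap B K).comp y) :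
    ∃ θ' : S →+* B, (algebraMap B K).comp θ' = θ := by
  have hinj := FaithfulSMul.algebraMap_injective B K
  have h1 : ∀ s, ∃ b, algebraMap B K b = θ s := fun s =>
    IsIntegrallyClosedIn.algebraMap_eq_of_integral
      ((Algebra.IsIntegral.isIntegral (R := P) s).map_of_comp_eq y θ h.symm)
  choose f hf using h1
  exact ⟨{ toFun := f
           map_one' := hinj (by simp [hf])
           map_zero' := hinj (by simp [hf])
           map_mul' := fun a b => hinj (by simp [hf])
           map_add' := fun a b => hinj (by simp [hf]) }, RingHom.ext hf⟩

/-- A point of an irreducible affine complex variety is the specialization of a point over any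
integral domain `B` which is integrally closed in an algebraically closed field and has a nonzero
prime `J`, and this point may be chosen off a given proper closed subset. -/
theorem exists_algHom_specialization {R B K : Type*} [CommRing R] [IsDomain R] [Algebra ℂ R]
    [Algebra.FiniteType ℂ R] (e : R →ₐ[ℂ] ℂ) {q : R} (hq : q ≠ 0) [CommRing B] [IsDomain B]
    [Algebra ℂ B] [Field K] [IsAlgClosed K] [Algebra B K] [FaithfulSMul B K]
    [IsIntegrallyClosedIn B K] {J : Ideal B} [J.IsPrime] {t : B} (ht : t ∈ J) (ht0 : t ≠ 0) :
    ∃ ψ : R →ₐ[ℂ] B, (∀ r, ψ r - algebraMap ℂ B (e r) ∈ J) ∧ ψ q ≠ 0 := by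
  obtain ⟨d, g, hg, hfin⟩ := exists_finite_inj_algHom_of_fg ℂ R
  let P := MvPolynomial (Fin d) ℂ
  let : Algebra P R := g.toRingHom.toAlgebra
  have : Module.Finite P R := hfin
  have : FaithfulSMul P R := (faithfulSMul_iff_algebraMap_injective _ _).2 hg
  -- N is a nonzero multiple of q lying in P, so a homomorphism that does not kill N does not kill
  -- q.
  obtain ⟨N, hN, hN0⟩ := Submodule.ne_bot_iff _ |>.1
    (Ideal.comap_ne_bot_of_integral_mem (R := P) hq
    (Ideal.mem_span_singleton_self q) (Algebra.IsIntegral.isIntegral q))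
  obtain ⟨s, hs⟩ := Ideal.mem_span_singleton.1 (Ideal.mem_comap.1 hN)
  obtain ⟨w, hw⟩ : ∃ w, MvPolynomial.eval w N ≠ 0 := by
    by_contra! h
    exact hN0 (MvPolynomial.funext fun w => by rw [h w, map_zero])
  -- The line starts at the image a of the point e at parameter 0 and passes at parameter 1 through
  -- w, where N does not vanish. Substituting t for the parameter gives a B-point congruent to a
  -- modulo J at which N ≠ 0.
  let a : Fin d → ℂ := fun i => e (g (.X i))
  let line : P →ₐ[ℂ] Polynomial ℂ := MvPolynomial.aeval fun i =>
    Polynomial.C (a i) + Polynomial.X * Polynomial.C (w i - a i)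
  have hline : line N ≠ 0 := fun h0 => hw (by
    have h1 : (Polynomial.aeval (1 : ℂ)).comp line = MvPolynomial.aeval w :=
      MvPolynomial.algHom_ext fun i => by simp [line]
    have h2 := DFunLike.congr_fun h1 N
    rw [AlgHom.comp_apply, h0, map_zero, MvPolynomial.aeval_eq_eval] at h2
    exact h2.symm)
  let y : P →ₐ[ℂ] B := (Polynomial.aeval t).comp line
  have hyN : y N ≠ 0 := aeval_ne_zero_of_mem ht ht0 hline
  have hyJ : ∀ p, y p - algebraMap ℂ B (e (g p)) ∈ J := fun p => by
    have h1 : (Ideal.Quotient.mkₐ ℂ J).comp y =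
        (Ideal.Quotient.mkₐ ℂ J).comp ((Algebra.ofId ℂ B).comp (e.comp g)) :=
      MvPolynomial.algHom_ext fun i => by
        have h2 : Ideal.Quotient.mk J t = 0 := Ideal.Quotient.eq_zero_iff_mem.2 ht
        simp [y, line, a, h2, Algebra.ofId_apply]
    exact Ideal.Quotient.eq.1 (DFunLike.congr_fun h1 p)
  obtain ⟨S, _, _, _, _, _, j, hj, htrans⟩ := exists_integral_extension_transitive (P := P) (R := R)
  obtain ⟨θ, hθ⟩ := exists_extend_of_isIntegral (P := P) (S := S)
    ((algebraMap B K).comp y.toRingHom)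
  obtain ⟨θ', rfl⟩ := exists_codRestrict_of_isIntegral _ θ hθ
  have hθ' : ∀ p, θ' (algebraMap P S p) = y p := fun p =>
    FaithfulSMul.algebraMap_injective B K (RingHom.congr_fun hθ p)
  let : Algebra R S := j.toRingHom.toAlgebra
  have : IsScalarTower P R S := .of_algebraMap_eq fun p => (j.commutes p).symm
  have : Algebra.IsIntegral R S := .tower_top (R := P)
  have : (RingHom.ker e).IsPrime := RingHom.ker_isPrime _
  obtain ⟨Q, hQ, hQe⟩ := Ideal.exists_ideal_over_prime_of_isIntegral_of_isDomain (S := S)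
    (RingHom.ker e) (by
      rw [(RingHom.injective_iff_ker_eq_bot (algebraMap R S)).1 hj]
      exact bot_le)
  have hJC : ∀ c : ℂ, algebraMap ℂ B c ∈ J ↔ c = 0 := fun c => by
    refine ⟨fun h => ?_, fun h => by simp [h]⟩
    by_contra hc
    exact Ideal.IsPrime.ne_top' (J.eq_top_of_isUnit_mem h ((IsUnit.mk0 _ hc).map _))
  -- The lift θ' reduces modulo J to some prime of S above a, not necessarily to the prime Q above
  -- e. Both primes have the same trace on P, so an automorphism over P exchanges one for the other
  -- without altering y.
  obtain ⟨σ, hσ⟩ := htrans Q (J.comap θ') hQ inferInstance (by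
    ext p
    rw [Ideal.under_def, Ideal.mem_comap, Ideal.under_def, Ideal.mem_comap, Ideal.mem_comap, hθ',
      IsScalarTower.algebraMap_apply P R S, ← Ideal.mem_comap, hQe, RingHom.mem_ker,
      ← hJC, ← Ideal.add_mem_iff_right J (hyJ p)]
    exact iff_of_eq (congrArg (· ∈ J) (sub_add_cancel _ _)))
  have hψ : ∀ p : P, θ' (σ (j (algebraMap P R p))) = y p := fun p => by
    rw [j.commutes, σ.commutes, hθ']
  have hC : ∀ c : ℂ, θ' (σ (j (algebraMap ℂ R c))) = algebraMap ℂ B c := fun c => by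
    have h1 : algebraMap ℂ R c = algebraMap P R (MvPolynomial.C c) := (g.commutes c).symm
    rw [h1]
    exact (hψ _).trans (y.commutes c)
  refine ⟨{ (θ'.comp (σ : S →+* S)).comp (j : R →+* S) with commutes' := hC }, fun r => ?_,
    fun h0 => hyN ?_⟩
  · change θ' (σ (j r)) - _ ∈ J
    rw [← hC, ← map_sub, ← map_sub, ← map_sub, ← Ideal.mem_comap]
    change _ ∈ (J.comap θ').comap σ
    rw [hσ]
    change algebraMap R S _ ∈ Q
    rw [← Ideal.mem_comap, hQe, RingHom.mem_ker, map_sub, AlgHom.commutes]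
    exact sub_self _
  · rw [← hψ, hs, map_mul, map_mul, map_mul]
    exact mul_eq_zero_of_left h0 _

end Lifting

/-! ### The universal isomorphism and its coordinate ring. -/

section Universal

variable {n : ℕ}

/-- The matrices of variables in the universal isomorphism between two Lie algebras. -/
noncomputable def isoVar (A : Type*) [CommRing A]
    (s : Fin n × Fin n → (Fin n × Fin n) ⊕ (Fin n × Fin n)) :
    Matrix (Fin n) (Fin n) (MvPolynomial ((Fin n × Fin n) ⊕ (Fin n × Fin n)) A) :=
  Matrix.of fun i j => .X (s (i, j))

/-- The equations between the entries of a matrix, of its inverse, and the structure constants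
`c`, `d`, which say that the matrix is an isomorphism of Lie algebras. -/
def isoRel {R : Type*} [CommRing R] (c d : Fin n × Fin n × Fin n → R)
    (f g : Matrix (Fin n) (Fin n) R) :
    (Fin n × Fin n) ⊕ (Fin n × Fin n) ⊕ (Fin n × Fin n × Fin n) → R
  | .inl (i, j) => (f * g - 1) i j
  | .inr (.inl (i, j)) => (g * f - 1) i j
  | .inr (.inr (i, j, k)) =>
    ∑ l, c (i, j, l) * f k l - ∑ a, ∑ b, f a i * f b j * d (a, b, k)

/-- `f` is an isomorphism, with inverse `g`, between the Lie algebras with structure constants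
`c` and `d`. -/
def IsIsoMatrix {R : Type*} [CommRing R] (c d : Fin n × Fin n × Fin n → R)
    (f g : Matrix (Fin n) (Fin n) R) : Prop :=
  ∀ r, isoRel c d f g r = 0

theorem isIsoMatrix_iff {R : Type*} [CommRing R] {c d : Fin n × Fin n × Fin n → R}
    {f g : Matrix (Fin n) (Fin n) R} :
    IsIsoMatrix c d f g ↔ f * g = 1 ∧ g * f = 1 ∧
      ∀ i j k, ∑ l, c (i, j, l) * f k l = ∑ a, ∑ b, f a i * f b j * d (a, b, k) := by
  constructor
  · exact fun h => ⟨sub_eq_zero.1 (Matrix.ext fun i j => h (.inl (i, j))),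
      sub_eq_zero.1 (Matrix.ext fun i j => h (.inr (.inl (i, j)))),
      fun i j k => sub_eq_zero.1 (h (.inr (.inr (i, j, k))))⟩
  · rintro ⟨h1, h2, h3⟩ (⟨i, j⟩ | ⟨i, j⟩ | ⟨i, j, k⟩)
    · simp [isoRel, h1]
    · simp [isoRel, h2]
    · exact sub_eq_zero.2 (h3 i j k)

theorem isoSC_iff_isoRel {R : Type*} [CommRing R] {c d : Fin n × Fin n × Fin n → R} :
    IsoSC c d ↔ ∃ f g : Matrix (Fin n) (Fin n) R, ∀ r, isoRel c d f g r = 0 :=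
  exists_congr fun _ => exists_congr fun _ => isIsoMatrix_iff.symm

theorem map_isoRel {R S : Type*} [CommRing R] [CommRing S] (φ : R →+* S)
    (c d : Fin n × Fin n × Fin n → R) (f g : Matrix (Fin n) (Fin n) R) (r) :
    φ (isoRel c d f g r) = isoRel (φ ∘ c) (φ ∘ d) (φ.mapMatrix f) (φ.mapMatrix g) r := by
  rcases r with ⟨i, j⟩ | ⟨i, j⟩ | ⟨i, j, k⟩
  · simp only [isoRel, ← map_mul, ← map_one φ.mapMatrix, ← map_sub]
    rfl
  · simp only [isoRel, ← map_mul, ← map_one φ.mapMatrix, ← map_sub]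
    rfl
  · simp [isoRel]

/-- The ideal of the relations between the entries of the universal isomorphism. -/
noncomputable def isoIdeal {A : Type*} [CommRing A] (c d : Fin n × Fin n × Fin n → A) :
    Ideal (MvPolynomial ((Fin n × Fin n) ⊕ (Fin n × Fin n)) A) :=
  Ideal.span (Set.range (isoRel (MvPolynomial.C ∘ c) (MvPolynomial.C ∘ d)
    (isoVar A Sum.inl) (isoVar A Sum.inr)))

/-- The coordinate ring of the scheme of isomorphisms between the Lie algebras with structure
constants `c` and `d`. -/
abbrev IsoRing {A : Type*} [CommRing A] (c d : Fin n × Fin n × Fin n → A) : Type _ :=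
  MvPolynomial ((Fin n × Fin n) ⊕ (Fin n × Fin n)) A ⧸ isoIdeal c d

theorem nonempty_isoRing_algHom_iff {A E : Type*} [CommRing A] [CommRing E] [Algebra A E]
    (c d : Fin n × Fin n × Fin n → A) :
    Nonempty (IsoRing c d →ₐ[A] E) ↔ IsoSC (algebraMap A E ∘ c) (algebraMap A E ∘ d) := by
  have hC : ∀ (φ : MvPolynomial ((Fin n × Fin n) ⊕ (Fin n × Fin n)) A →ₐ[A] E)
      (c : Fin n × Fin n × Fin n → A),
      φ.toRingHom ∘ MvPolynomial.C ∘ c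
        = algebraMap A E ∘ c := fun φ c => funext fun p => φ.commutes (c p)
  rw [isoSC_iff_isoRel]
  constructor
  · rintro ⟨φ⟩
    let φ' := φ.comp (Ideal.Quotient.mkₐ A (isoIdeal c d))
    refine ⟨φ'.toRingHom.mapMatrix (isoVar A Sum.inl),
      φ'.toRingHom.mapMatrix (isoVar A Sum.inr), fun r => ?_⟩
    rw [← hC φ' c, ← hC φ' d, ← map_isoRel]
    change φ (Ideal.Quotient.mk (isoIdeal c d) _) = 0
    exact (congrArg φ (Ideal.Quotient.eq_zero_iff_mem.2
      (Ideal.subset_span (Set.mem_range_self r)))).trans (map_zero φ)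
  · rintro ⟨f, g, h⟩
    let φ : MvPolynomial ((Fin n × Fin n) ⊕ (Fin n × Fin n)) A →ₐ[A] E :=
      MvPolynomial.aeval (Sum.elim (fun p => f p.1 p.2) (fun p => g p.1 p.2))
    have hf : φ.toRingHom.mapMatrix (isoVar A Sum.inl) = f := by
      ext i j; simp [isoVar, φ]
    have hg : φ.toRingHom.mapMatrix (isoVar A Sum.inr) = g := by
      ext i j; simp [isoVar, φ]
    refine ⟨Ideal.Quotient.liftₐ _ φ fun a ha => ?_⟩
    have : isoIdeal c d ≤ RingHom.ker φ := Ideal.span_le.2 (by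
      rintro _ ⟨r, rfl⟩
      change φ.toRingHom _ = 0
      rw [map_isoRel, hC, hC, hf, hg, h r])
    exact this ha

/-- If the fibre ring κ ⊗ S is nonzero, its quotient by a maximal ideal is a finite extension of the
residue field κ (Nullstellensatz), and so embeds over κ in E. -/
theorem nonempty_algHom_iff_ker_mem_range {A S E : Type*} [CommRing A] [CommRing S] [Algebra A S]
    [Algebra.FiniteType A S] [Field E] [IsAlgClosed E] [Algebra A E] :
    Nonempty (S →ₐ[A] E) ↔ (⟨RingHom.ker (algebraMap A E), RingHom.ker_isPrime _⟩ : PrimeSpectrum A)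
      ∈ Set.range (PrimeSpectrum.comap (algebraMap A S)) := by
  constructor
  · rintro ⟨φ⟩
    refine ⟨⟨RingHom.ker φ, RingHom.ker_isPrime _⟩, PrimeSpectrum.ext (Ideal.ext fun a => ?_)⟩
    change φ (algebraMap A S a) = 0 ↔ algebraMap A E a = 0
    rw [φ.commutes]
  · intro h
    have hp : (RingHom.ker (algebraMap A E)).IsPrime := RingHom.ker_isPrime _
    let κ := (RingHom.ker (algebraMap A E)).ResidueField
    rw [← PrimeSpectrum.nontrivial_iff_mem_rangeComap] at h
    have hn : Nontrivial (κ ⊗[A] S) := h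
    obtain ⟨m, hm⟩ := Ideal.exists_maximal (κ ⊗[A] S)
    let : Field ((κ ⊗[A] S) ⧸ m) := Ideal.Quotient.field m
    have : Module.Finite κ ((κ ⊗[A] S) ⧸ m) := finite_of_finite_type_of_isJacobsonRing _ _
    let l : κ →ₐ[A] E := Ideal.ResidueField.liftₐ _ (Algebra.ofId A E) le_rfl (fun a ha =>
      IsUnit.mk0 _ ha)
    let : Algebra κ E := l.toRingHom.toAlgebra
    have : IsScalarTower A κ E := .of_algebraMap_eq fun a => (l.commutes a).symm
    have hinj : Function.Injective (algebraMap κ ((κ ⊗[A] S) ⧸ m)) := RingHom.injective _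
    have : Module.IsTorsionFree κ ((κ ⊗[A] S) ⧸ m) :=
      Module.isTorsionFree_iff_algebraMap_injective.2 hinj
    let φ : ((κ ⊗[A] S) ⧸ m) →ₐ[κ] E := IsAlgClosed.lift
    exact ⟨((φ.restrictScalars A).comp ((Ideal.Quotient.mkₐ κ m).restrictScalars A)).comp
      Algebra.TensorProduct.includeRight⟩

/-! ### The Lie laws and the orbit as constructible subsets of the spectrum. -/

/-- The generic structure constants. -/
noncomputable abbrev genericSC (n : ℕ) :
    Fin n × Fin n × Fin n → MvPolynomial (Fin n × Fin n × Fin n) ℂ := MvPolynomial.X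

/-- The variety of complex Lie algebras, as a subset of the prime spectrum. -/
def lieLocus (n : ℕ) : Set (PrimeSpectrum (MvPolynomial (Fin n × Fin n × Fin n) ℂ)) :=
  PrimeSpectrum.zeroLocus (Set.range fun r => lieRel r (genericSC n))

/-- The orbit of `d`, as a subset of the prime spectrum. -/
def isoLocus (d : Fin n × Fin n × Fin n → ℂ) :
    Set (PrimeSpectrum (MvPolynomial (Fin n × Fin n × Fin n) ℂ)) :=
  Set.range (PrimeSpectrum.comap (algebraMap _ (IsoRing (genericSC n) (MvPolynomial.C ∘ d))))

/-- Chevalley's theorem: the coordinate ring of isomorphisms is finitely presented over a Noetherian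
ring. -/
theorem isConstructible_isoLocus (d : Fin n × Fin n × Fin n → ℂ) :
    Topology.IsConstructible (isoLocus d) := by
  refine PrimeSpectrum.isConstructible_range_comap (RingHom.finitePresentation_algebraMap.2 ?_)
  exact Algebra.FinitePresentation.of_finiteType.1 inferInstance

theorem isConstructible_of_isOpen_noetherian {A : Type*} [CommRing A] [IsNoetherianRing A]
    {U : Set (PrimeSpectrum A)} (hU : IsOpen U) : Topology.IsConstructible U :=
  (TopologicalSpace.NoetherianSpace.isCompact U).isConstructible hU

theorem isConstructible_lieLocus : Topology.IsConstructible (lieLocus n) :=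
  Topology.isConstructible_compl.1 (isConstructible_of_isOpen_noetherian
    (PrimeSpectrum.isClosed_zeroLocus _).isOpen_compl)

/-- The point of the prime spectrum below a family of structure constants over a field. -/
noncomputable def kerPoint {E : Type*} [Field E] [Algebra ℂ E] (c : Fin n × Fin n × Fin n → E) :
    PrimeSpectrum (MvPolynomial (Fin n × Fin n × Fin n) ℂ) :=
  ⟨RingHom.ker (MvPolynomial.aeval (R := ℂ) c), RingHom.ker_isPrime _⟩

theorem mem_kerPoint {E : Type*} [Field E] [Algebra ℂ E] {c : Fin n × Fin n × Fin n → E} {p} :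
    p ∈ (kerPoint c).asIdeal ↔ MvPolynomial.aeval c p = 0 := Iff.rfl

theorem kerPoint_mem_lieLocus {E : Type*} [Field E] [Algebra ℂ E]
    {c : Fin n × Fin n × Fin n → E} : kerPoint c ∈ lieLocus n ↔ IsLieSC c := by
  rw [lieLocus, PrimeSpectrum.mem_zeroLocus, Set.range_subset_iff]
  refine forall_congr' fun r => ?_
  rw [SetLike.mem_coe, mem_kerPoint]
  change (MvPolynomial.aeval c).toRingHom _ = 0 ↔ _
  rw [map_lieRel]
  refine iff_of_eq (congrArg (lieRel r · = 0) (funext fun p => ?_))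
  simp

/-- Over an algebraically closed field, being isomorphic to d depends only on the prime of
polynomial relations satisfied by the structure constants. This lets complex points control points
over E. -/
theorem kerPoint_mem_isoLocus {E : Type*} [Field E] [IsAlgClosed E] [Algebra ℂ E]
    {c : Fin n × Fin n × Fin n → E} {d : Fin n × Fin n × Fin n → ℂ} :
    kerPoint c ∈ isoLocus d ↔ IsoSC c (algebraMap ℂ E ∘ d) := by
  let : Algebra (MvPolynomial (Fin n × Fin n × Fin n) ℂ) E :=
    (MvPolynomial.aeval (R := ℂ) c).toRingHom.toAlgebra
  have h := nonempty_isoRing_algHom_iff (E := E) (genericSC n) (MvPolynomial.C ∘ d)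
  rw [nonempty_algHom_iff_ker_mem_range] at h
  have h1 : algebraMap (MvPolynomial (Fin n × Fin n × Fin n) ℂ) E ∘ genericSC n = c :=
    funext fun p => MvPolynomial.aeval_X c p
  have h2 : algebraMap (MvPolynomial (Fin n × Fin n × Fin n) ℂ) E ∘ MvPolynomial.C ∘ d
      = algebraMap ℂ E ∘ d := funext fun p => MvPolynomial.aeval_C c (d p)
  rw [h1, h2] at h
  exact h

theorem exists_kerPoint_of_isClosed {x : PrimeSpectrum (MvPolynomial (Fin n × Fin n × Fin n) ℂ)}
    (hx : x ∈ closedPoints (PrimeSpectrum (MvPolynomial (Fin n × Fin n × Fin n) ℂ))) :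
    ∃ c : Fin n × Fin n × Fin n → ℂ, x = kerPoint c := by
  have hm : x.asIdeal.IsMaximal := (PrimeSpectrum.isClosed_singleton_iff_isMaximal x).1 hx
  obtain ⟨c, hc⟩ := MvPolynomial.eq_vanishingIdeal_singleton_of_isMaximal ℂ hm
  refine ⟨c, PrimeSpectrum.ext (hc.trans (Ideal.ext fun p => ?_))⟩
  rw [MvPolynomial.mem_vanishingIdeal_singleton_iff, mem_kerPoint]

/-- A nonempty constructible set contains a complex point. -/
theorem exists_kerPoint_mem_of_isConstructible
    {T : Set (PrimeSpectrum (MvPolynomial (Fin n × Fin n × Fin n) ℂ))}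
    (hT : Topology.IsConstructible T) (hne : T.Nonempty) :
    ∃ c : Fin n × Fin n × Fin n → ℂ, kerPoint c ∈ T := by
  obtain ⟨D, rfl⟩ := PrimeSpectrum.exists_constructibleSetData_iff.2 hT
  obtain ⟨x, hx⟩ := hne
  obtain ⟨C, hC, hxC⟩ := Set.mem_iUnion₂.1 hx
  have hlc : IsLocallyClosed C.toSet := (PrimeSpectrum.isClosed_zeroLocus _).isLocallyClosed.inter
    (PrimeSpectrum.isClosed_zeroLocus _).isOpen_compl.isLocallyClosed
  -- In a Jacobson space every nonempty locally closed set contains a closed point, and closed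
  -- points are complex by the Nullstellensatz.
  obtain ⟨y, hy, hyc⟩ := jacobsonSpace_iff_locallyClosed.1 inferInstance _ ⟨x, hxC⟩ hlc
  obtain ⟨c, rfl⟩ := exists_kerPoint_of_isClosed hyc
  exact ⟨c, Set.mem_iUnion₂.2 ⟨C, hC, hy⟩⟩

/-- A point of the closure of a constructible set is a specialization of a point of an irreducible
locally closed subset of it. -/
theorem exists_le_of_mem_closure_isConstructible {A : Type*} [CommRing A]
    {T : Set (PrimeSpectrum A)} (hT : Topology.IsConstructible T) {x : PrimeSpectrum A}
    (hx : x ∈ closure T) : ∃ (y : PrimeSpectrum A) (q : A), y ≤ x ∧ q ∉ y.asIdeal ∧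
      ∀ z : PrimeSpectrum A, y ≤ z → q ∉ z.asIdeal → z ∈ T := by
  obtain ⟨D, rfl⟩ := PrimeSpectrum.exists_constructibleSetData_iff.2 hT
  replace hx : x ∈ closure (⋃ C ∈ (D : Set (PrimeSpectrum.BasicConstructibleSetData A)), C.toSet) :=
    hx
  rw [D.finite_toSet.closure_biUnion] at hx
  obtain ⟨C, hC, hxC⟩ := Set.mem_iUnion₂.1 hx
  -- A prime containing the equations of C and disjoint from M is a generization of x at which f
  -- does not vanish. One exists: if s f^k were in the ideal of the equations with s not in x, then
  -- s would vanish on C, hence on its closure, hence at x.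
  let M : Submonoid A := x.asIdeal.primeCompl ⊔ Submonoid.powers C.f
  have hdis : Disjoint (Ideal.span (Set.range C.g) : Set A) M := by
    rw [Set.disjoint_left]
    intro a ha haM
    obtain ⟨s, hs, _, ⟨k, rfl⟩, rfl⟩ := Submonoid.mem_sup.1 haM
    refine hs ?_
    have h1 : closure C.toSet ⊆ PrimeSpectrum.zeroLocus {s} := by
      refine closure_minimal ?_ (PrimeSpectrum.isClosed_zeroLocus _)
      rintro z ⟨hz1, hz2⟩
      rw [PrimeSpectrum.mem_zeroLocus, Set.singleton_subset_iff] at hz2 ⊢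
      rw [PrimeSpectrum.mem_zeroLocus] at hz1
      have h2 : s * C.f ^ k ∈ z.asIdeal := Ideal.span_le.2 hz1 ha
      exact (z.isPrime.mem_or_mem h2).resolve_right fun h => hz2 (z.isPrime.mem_of_pow_mem _ h)
    exact Set.singleton_subset_iff.1 (h1 hxC)
  obtain ⟨p, hp, hgp, hpM⟩ := Ideal.exists_le_prime_disjoint _ M hdis
  refine ⟨⟨p, hp⟩, C.f, fun a ha => ?_, fun h => ?_, fun z hz hq => ?_⟩
  · by_contra hax
    exact Set.disjoint_left.1 hpM ha (Submonoid.mem_sup_left (S := x.asIdeal.primeCompl) hax)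
  · exact Set.disjoint_left.1 hpM h (Submonoid.mem_sup_right (Submonoid.mem_powers _))
  · refine Set.mem_iUnion₂.2 ⟨C, hC, ?_, fun h => hq (Set.singleton_subset_iff.1 h)⟩
    exact (Ideal.span_le.1 hgp).trans hz

/-! ### Rigidity in terms of complex points and generic points. -/

namespace LieProduct

/-- The Lie laws with p ≠ 0 outside the orbit form a constructible set without complex points, which
is therefore empty; a counterexample over E would be a point of it. -/
theorem isoSC_of_aeval_ne_zero {μ : LieProduct ℂ n} {p : MvPolynomial (Fin n × Fin n × Fin n) ℂ}
    (hp : ∀ lam : LieProduct ℂ n, MvPolynomial.eval lam.structConst p ≠ 0 → lam ∈ μ.orbit)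
    {E : Type*} [Field E] [IsAlgClosed E] [Algebra ℂ E] {c : Fin n × Fin n × Fin n → E}
    (hc : IsLieSC c) (hpc : MvPolynomial.aeval c p ≠ 0) :
    IsoSC c (algebraMap ℂ E ∘ μ.structConst) := by
  rw [← kerPoint_mem_isoLocus]
  by_contra h
  have hT : Topology.IsConstructible
      (((PrimeSpectrum.basicOpen p : Set (PrimeSpectrum _)) ∩ lieLocus n) \
        isoLocus μ.structConst) :=
    ((isConstructible_of_isOpen_noetherian (PrimeSpectrum.basicOpen p).isOpen).inter
      isConstructible_lieLocus).sdiff (isConstructible_isoLocus _)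
  obtain ⟨a, ⟨ha1, ha2⟩, ha3⟩ := exists_kerPoint_mem_of_isConstructible hT
    ⟨kerPoint c, ⟨hpc, kerPoint_mem_lieLocus.2 hc⟩, h⟩
  rw [kerPoint_mem_lieLocus] at ha2
  refine ha3 (kerPoint_mem_isoLocus.2 ?_)
  have h1 := hp (ofStructConst a ha2) (by
    rw [structConst_ofStructConst, ← MvPolynomial.aeval_eq_eval]
    exact ha1)
  rwa [mem_orbit_iff, structConst_ofStructConst] at h1

theorem structConst_act {R : Type*} [CommRing R] (f : (Fin n → R) ≃ₗ[R] (Fin n → R))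
    (μ : LieProduct R n) (i j k : Fin n) :
    (act f μ).structConst (i, j, k) = ∑ l, (∑ a, ∑ b, f (Pi.single i 1) a * f (Pi.single j 1) b *
      μ.structConst (a, b, l)) * f.symm (Pi.single l 1) k := by
  simp only [← bracket_apply]
  change f.symm (μ.bracket (f (Pi.single i 1)) (f (Pi.single j 1))) k = _
  conv_lhs => rw [← (Pi.basisFun R (Fin n)).sum_repr (μ.bracket _ _)]
  simp

theorem act_mem_orbit_iff {R : Type*} [CommRing R] (f : (Fin n → R) ≃ₗ[R] (Fin n → R))
    {μ lam : LieProduct R n} : act f lam ∈ μ.orbit ↔ lam ∈ μ.orbit := by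
  obtain ⟨e⟩ := mem_orbit_iff_lieEquiv.1 (⟨f, rfl⟩ : act f lam ∈ lam.orbit)
  rw [mem_orbit_iff_lieEquiv, mem_orbit_iff_lieEquiv]
  exact ⟨fun ⟨e'⟩ => ⟨e.symm.trans e'⟩, fun ⟨e'⟩ => ⟨e.trans e'⟩⟩

theorem act_symm_act {R : Type*} [CommRing R] (f : (Fin n → R) ≃ₗ[R] (Fin n → R))
    (μ : LieProduct R n) : act f.symm (act f μ) = μ := by
  ext1
  refine LinearMap.ext fun X => LinearMap.ext fun Y => ?_
  simp [act]

theorem exists_eval_act (f : (Fin n → ℂ) ≃ₗ[ℂ] (Fin n → ℂ))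
    (p : MvPolynomial (Fin n × Fin n × Fin n) ℂ) :
    ∃ q, ∀ lam : LieProduct ℂ n,
      MvPolynomial.eval lam.structConst q = MvPolynomial.eval (act f lam).structConst p := by
  refine ⟨MvPolynomial.aeval (fun s : Fin n × Fin n × Fin n => ∑ l, (∑ a, ∑ b,
    MvPolynomial.C (f (Pi.single s.1 1) a) * MvPolynomial.C (f (Pi.single s.2.1 1) b) *
      MvPolynomial.X (a, b, l)) * MvPolynomial.C (f.symm (Pi.single l 1) s.2.2)) p, fun lam => ?_⟩
  rw [← MvPolynomial.aeval_eq_eval, ← MvPolynomial.aeval_eq_eval, MvPolynomial.comp_aeval_apply]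
  congr 2
  funext ⟨i, j, k⟩
  simp [structConst_act]

/-- The orbit is homogeneous: a principal neighbourhood of μ inside it is carried by the group to a
neighbourhood of any other point. -/
theorem isZariskiOpen_orbit_of_exists {μ : LieProduct ℂ n}
    {p : MvPolynomial (Fin n × Fin n × Fin n) ℂ} (hμ : MvPolynomial.eval μ.structConst p ≠ 0)
    (hp : ∀ lam : LieProduct ℂ n, MvPolynomial.eval lam.structConst p ≠ 0 → lam ∈ μ.orbit) :
    μ.IsRigid := by
  refine ⟨{q | ∀ lam : LieProduct ℂ n, MvPolynomial.eval lam.structConst q ≠ 0 → lam ∈ μ.orbit},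
    Set.ext fun lam => ⟨?_, fun ⟨q, hq, h⟩ => hq lam h⟩⟩
  rintro ⟨f, rfl⟩
  obtain ⟨q, hq⟩ := exists_eval_act f.symm p
  refine ⟨q, fun lam h => ?_, ?_⟩
  · rw [hq] at h
    exact (act_mem_orbit_iff _).1 (hp _ h)
  · change MvPolynomial.eval (act f μ).structConst q ≠ 0
    rwa [hq, act_symm_act]

/-- Otherwise μ would have a principal open neighbourhood containing no Lie law outside the orbit,
which would make it rigid. -/
theorem exists_generic_nonorbit {μ : LieProduct ℂ n} (hμ : ¬ μ.IsRigid) :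
    ∃ (y : PrimeSpectrum (MvPolynomial (Fin n × Fin n × Fin n) ℂ))
      (q : MvPolynomial (Fin n × Fin n × Fin n) ℂ),
      y ≤ kerPoint μ.structConst ∧ q ∉ y.asIdeal ∧
      ∀ z : PrimeSpectrum (MvPolynomial (Fin n × Fin n × Fin n) ℂ), y ≤ z → q ∉ z.asIdeal →
        z ∈ lieLocus n \ isoLocus μ.structConst := by
  refine exists_le_of_mem_closure_isConstructible
    (isConstructible_lieLocus.sdiff (isConstructible_isoLocus _)) ?_
  by_contra hcl
  obtain ⟨_, ⟨p, rfl⟩, hp, hsub⟩ :=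
    PrimeSpectrum.isTopologicalBasis_basic_opens.exists_subset_of_mem_open hcl isClosed_closure.isOpen_compl
  refine hμ (isZariskiOpen_orbit_of_exists (p := p) ?_ fun lam hl => ?_)
  · rw [← MvPolynomial.aeval_eq_eval]
    exact hp
  · by_contra hlam
    rw [mem_orbit_iff] at hlam
    refine hsub (a := kerPoint lam.structConst) ?_ (subset_closure
      ⟨kerPoint_mem_lieLocus.2 lam.isLieSC_structConst, fun h => hlam (kerPoint_mem_isoLocus.1 h)⟩)
    rw [← MvPolynomial.aeval_eq_eval] at hl
    exact hl

end LieProduct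

end Universal

/-! ### Evaluation of extended functions at nonstandard points. -/

namespace RobinsonExtension

open FirstOrder FirstOrder.Language FirstOrder.Language.Structure

variable {F : Type*} [Field F] [Algebra ℂ F] [RobinsonExtension F]

/-- The term `f(x₁, …, x_k)`. -/
def funTerm {k : ℕ} (f : (Fin k → ℂ) → ℂ) : fullLanguage.Term (Fin k) :=
  Term.func (funSym f) Term.var

/-- The value at `x` of the extension of a function `f` on `ℂ^k`. -/
def starEval {k : ℕ} (x : Fin k → F) (f : (Fin k → ℂ) → ℂ) : F := (funTerm f).realize x

theorem starEval_apply {k : ℕ} (x : Fin k → F) (i : Fin k) : starEval x (fun v => v i) = x i := by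
  have h := transfer (F := F) (Term.equal (funTerm fun v : Fin k → ℂ => v i) (Term.var i))
    (fun v => by rw [Formula.realize_equal]; rfl) x
  rw [Formula.realize_equal] at h
  exact h

theorem starEval_add {k : ℕ} (x : Fin k → F) (f g : (Fin k → ℂ) → ℂ) :
    starEval x (f + g) = starEval x f + starEval x g := by
  have h := transfer (F := F) (Term.equal (funTerm (f + g))
    ((funSym fun v : Fin 2 → ℂ => v 0 + v 1).apply₂ (funTerm f) (funTerm g)))
    (fun v => by rw [Formula.realize_equal, Term.realize_functions_apply₂]; rfl) x
  rw [Formula.realize_equal, Term.realize_functions_apply₂, funMap_add] at h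
  exact h

theorem starEval_mul {k : ℕ} (x : Fin k → F) (f g : (Fin k → ℂ) → ℂ) :
    starEval x (f * g) = starEval x f * starEval x g := by
  have h := transfer (F := F) (Term.equal (funTerm (f * g))
    ((funSym fun v : Fin 2 → ℂ => v 0 * v 1).apply₂ (funTerm f) (funTerm g)))
    (fun v => by rw [Formula.realize_equal, Term.realize_functions_apply₂]; rfl) x
  rw [Formula.realize_equal, Term.realize_functions_apply₂, funMap_mul] at h
  exact h

/-- Transfer identifies the constant function of k variables with the nullary symbol of the same
value, whose interpretation `emb` determines. -/
theorem starEval_const {k : ℕ} (x : Fin k → F) (z : ℂ) :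
    starEval x (fun _ => z) = algebraMap ℂ F z := by
  have h := transfer (F := F) (Term.equal (funTerm fun _ : Fin k → ℂ => z)
    (Term.func (funSym fun _ : Fin 0 → ℂ => z) Fin.elim0))
    (fun v => by rw [Formula.realize_equal]; rfl) x
  rw [Formula.realize_equal] at h
  refine h.trans ?_
  rw [← emb_apply, Term.realize_func]
  have h1 := (emb (F := F)).map_fun (funSym fun _ : Fin 0 → ℂ => z) Fin.elim0
  refine Eq.trans (congrArg _ (funext fun i => i.elim0)) h1.symm

theorem boundedBy_starEval {k : ℕ} (x : Fin k → F) {f : (Fin k → ℂ) → ℂ} {r : ℝ}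
    (h : ∀ v, ‖f v‖ ≤ r) : BoundedBy r (starEval x f) :=
  (realize_leFormula r (funTerm f) x).1 (transfer (F := F) (leFormula r (funTerm f))
    (fun v => (realize_leFormula_complex r _ v).2 (h v)) x)

theorem starEval_eq_zero {k : ℕ} (x : Fin k → F) {f g : (Fin k → ℂ) → ℂ} {r : ℝ}
    (h : ∀ v, ‖f v‖ ≤ r → g v = 0) (hf : BoundedBy r (starEval x f)) : starEval x g = 0 := by
  have h1 := transfer (F := F) ((leFormula r (funTerm f)).imp
    (Term.equal (funTerm g) (funTerm fun _ => 0))) (fun v => by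
      rw [Formula.realize_imp, realize_leFormula_complex, Formula.realize_equal]
      exact h v) x
  rw [Formula.realize_imp, realize_leFormula, Formula.realize_equal] at h1
  exact (h1 hf).trans ((starEval_const x 0).trans (map_zero _))

/-- Evaluation at `x ∈ F^ι` of the extensions of the functions on `ℂ^ι`. -/
theorem exists_starEvalHom {ι : Type*} [Finite ι] (x : ι → F) :
    ∃ φ : ((ι → ℂ) → ℂ) →ₐ[ℂ] F, (∀ i, φ (fun v => v i) = x i) ∧
      (∀ (f : (ι → ℂ) → ℂ) (r : ℝ), (∀ v, ‖f v‖ ≤ r) → BoundedBy r (φ f)) ∧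
      ∀ (f g : (ι → ℂ) → ℂ) (r : ℝ), (∀ v, ‖f v‖ ≤ r → g v = 0) → BoundedBy r (φ f) → φ g = 0 := by
  obtain ⟨k, ⟨e⟩⟩ := Finite.exists_equiv_fin ι
  refine ⟨{ toFun := fun f => starEval (x ∘ e.symm) (fun v => f (v ∘ e))
            map_one' := (starEval_const _ 1).trans (map_one _)
            map_zero' := (starEval_const _ 0).trans (map_zero _)
            map_mul' := fun f g => starEval_mul _ _ _
            map_add' := fun f g => starEval_add _ _ _
            commutes' := fun z => starEval_const _ z }, fun i => ?_, fun f r h => ?_,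
    fun f g r h hf => ?_⟩
  · exact (starEval_apply (x ∘ e.symm) (e i)).trans (congrArg x (e.symm_apply_apply i))
  · exact boundedBy_starEval _ fun v => h _
  · exact starEval_eq_zero _ (fun v => h _) hf

/-- Choose a complex root as a function ρ of the lower coefficients of a monic polynomial. The
identity expressing this holds in the ring of functions, hence after evaluation at coefficients in
F. -/
theorem isAlgClosed : IsAlgClosed F := by
  refine IsAlgClosed.of_exists_root F fun p hp hirr => ?_
  have hroot : ∀ v : Fin p.natDegree → ℂ, ∃ z : ℂ,
      z ^ p.natDegree + ∑ i, v i * z ^ (i : ℕ) = 0 := fun v => by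
    let q : Polynomial ℂ := .X ^ p.natDegree + ∑ i : Fin p.natDegree, .C (v i) * .X ^ (i : ℕ)
    have hlt : (∑ i, Polynomial.C (v i) * .X ^ (i : ℕ)).degree < (p.natDegree : WithBot ℕ) :=
      Polynomial.degree_sum_fin_lt v
    have hq : q.degree = p.natDegree := by
      rw [Polynomial.degree_add_eq_left_of_degree_lt, Polynomial.degree_X_pow]
      rwa [Polynomial.degree_X_pow]
    obtain ⟨z, hz⟩ := IsAlgClosed.exists_root q (by
      rw [hq]
      exact_mod_cast hirr.natDegree_pos.ne')
    refine ⟨z, ?_⟩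
    simpa [q, Polynomial.IsRoot, Polynomial.eval_finsetSum] using hz
  choose ρ hρ using hroot
  obtain ⟨φ, hφ, -⟩ := exists_starEvalHom (F := F) (fun i : Fin p.natDegree => p.coeff i)
  refine ⟨φ ρ, ?_⟩
  have h : ρ ^ p.natDegree + ∑ i, (fun v : Fin p.natDegree → ℂ => v i) * ρ ^ (i : ℕ) = 0 :=
    funext fun v => by simpa using hρ v
  have h1 := congrArg φ h
  simp only [map_add, map_pow, map_sum, map_mul, map_zero, hφ] at h1
  have h2 := congrArg (Polynomial.eval (φ ρ)) hp.as_sum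
  rw [h2]
  simpa [Polynomial.eval_finsetSum, Finset.sum_range] using h1

/-- The inverse of an unlimited element. -/
theorem exists_mem_maximalIdeal_limited :
    ∃ t ∈ IsLocalRing.maximalIdeal (limited F), t ≠ 0 := by
  obtain ⟨x, hx⟩ := nonarchimedean (F := F)
  have hxA : x ∉ limited F := fun ⟨r, hr⟩ => hx r hr
  have hx0 : x ≠ 0 := fun h => hxA (h ▸ zero_mem _)
  refine ⟨⟨x⁻¹, ((limited F).mem_or_inv_mem x).resolve_left hxA⟩, fun hu => hxA ?_,
    fun h => hx0 (inv_eq_zero.1 (congrArg Subtype.val h))⟩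
  obtain ⟨y, hy⟩ := hu.exists_right_inv
  have h1 : x⁻¹ * (y : F) = 1 := congrArg Subtype.val hy
  rw [inv_mul_eq_one₀ hx0] at h1
  exact h1 ▸ y.2

/-- Of δ⁻¹y and its inverse, one is bounded by 1. If it is the inverse, then y⁻¹ is limited and y is
a unit of A. -/
theorem boundedBy_of_mem_maximalIdeal {y : limited F}
    (hy : y ∈ IsLocalRing.maximalIdeal (limited F)) {δ : ℝ} (hδ : 0 < δ) : BoundedBy δ (y : F) := by
  by_cases hy0 : y = 0
  · have h := boundedBy_starEval (fun i : Fin 0 => (i.elim0 : F)) (f := fun _ => 0) (r := δ)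
      (fun _ => by simpa using hδ.le)
    rw [starEval_const, map_zero] at h
    rw [hy0]
    exact h
  have hy0' : (y : F) ≠ 0 := fun h => hy0 (Subtype.ext h)
  have hδ0 : algebraMap ℂ F δ ≠ 0 :=
    (map_ne_zero _).2 (Complex.ofReal_ne_zero.2 hδ.ne')
  have hb := boundedBy_algebraMap (F := F) (δ : ℂ)
  have hbi := boundedBy_algebraMap (F := F) ((δ : ℂ)⁻¹)
  rcases boundedBy_one_of_mul_eq_one (F := F) (x := algebraMap ℂ F (δ : ℂ)⁻¹ * y)
    (y := algebraMap ℂ F δ * (y : F)⁻¹) (by rw [map_inv₀]; field_simp) with h | h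
  · have h1 := hb.mul h
    rw [map_inv₀, mul_inv_cancel_left₀ hδ0] at h1
    simpa [abs_of_pos hδ] using h1
  · have h1 := hbi.mul h
    rw [map_inv₀, inv_mul_cancel_left₀ hδ0] at h1
    exact absurd (IsUnit.of_mul_eq_one (⟨(y : F)⁻¹, _, h1⟩ : limited F)
      (Subtype.ext (mul_inv_cancel₀ hy0'))) hy

end RobinsonExtension

/-- In the ring of all functions, membership in a finitely generated ideal is decided by zero sets.
Applied to the kernel of an evaluation, this turns an implication between equations over ℂ into one
over F. -/
theorem mem_ideal_of_forall_zero {X ι : Type*} [Finite ι] {I : Ideal (X → ℂ)} {h : ι → X → ℂ}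
    (hI : ∀ i, h i ∈ I) {g : X → ℂ} (hg : ∀ x, (∀ i, h i x = 0) → g x = 0) : g ∈ I := by
  have := Fintype.ofFinite ι
  -- The denominator is the sum of the |h_j|²; where it is zero all h_j vanish, so g does too and
  -- the convention for division by zero is harmless.
  have h1 : g = ∑ i, (fun x => g x * star (h i x) / ∑ j, h j x * star (h j x)) * h i := by
    funext x
    simp only [Finset.sum_apply, Pi.mul_apply]
    by_cases hx : ∑ j, h j x * star (h j x) = 0
    · rw [hg x fun i => ?_]
      · simp
      · have h2 : ∑ j, ‖h j x‖ ^ 2 = 0 := by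
          have : ((∑ j, ‖h j x‖ ^ 2 : ℝ) : ℂ) = 0 := by
            rw [← hx]
            push_cast
            exact Finset.sum_congr rfl fun j _ => (Complex.mul_conj' _).symm
          exact_mod_cast this
        rw [Finset.sum_eq_zero_iff_of_nonneg fun _ _ => sq_nonneg _] at h2
        simpa using h2 i (Finset.mem_univ i)
    · have h3 : ∀ i, g x * star (h i x) / (∑ j, h j x * star (h j x)) * h i x =
          g x * (∑ j, h j x * star (h j x))⁻¹ * (h i x * star (h i x)) := fun i => by ring
      simp only [h3]
      rw [← Finset.mul_sum, mul_assoc, inv_mul_cancel₀ hx, mul_one]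
  rw [h1]
  exact I.sum_mem fun i _ => I.mul_mem_left _ (hI i)

/-! ### Composition of matrix isomorphisms. -/

section IsoMatrix

variable {n : ℕ} {R : Type*} [CommRing R]

theorem IsIsoMatrix.isoSC {c d : Fin n × Fin n × Fin n → R} {f g : Matrix (Fin n) (Fin n) R}
    (h : IsIsoMatrix c d f g) : IsoSC c d := ⟨f, g, isIsoMatrix_iff.1 h⟩

theorem IsIsoMatrix.trans {c d e : Fin n × Fin n × Fin n → R}
    {f g f' g' : Matrix (Fin n) (Fin n) R} (h : IsIsoMatrix c d f g) (h' : IsIsoMatrix d e f' g') :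
    IsIsoMatrix c e (f' * f) (g * g') := by
  rw [isIsoMatrix_iff] at h h' ⊢
  obtain ⟨h1, h2, h3⟩ := h
  obtain ⟨h1', h2', h3'⟩ := h'
  refine ⟨?_, ?_, fun i j k => ?_⟩
  · rw [mul_assoc, ← mul_assoc f, h1, one_mul, h1']
  · rw [mul_assoc, ← mul_assoc g', h2', one_mul, h2]
  · calc ∑ l, c (i, j, l) * (f' * f) k l = ∑ m, (∑ l, c (i, j, l) * f m l) * f' k m := by
          simp only [Matrix.mul_apply, Finset.mul_sum, Finset.sum_mul]
          rw [Finset.sum_comm]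
          exact Finset.sum_congr rfl fun _ _ => Finset.sum_congr rfl fun _ _ => by ring
      _ = ∑ a, ∑ b, f a i * f b j * ∑ m, d (a, b, m) * f' k m := by
          simp only [h3, Finset.mul_sum, Finset.sum_mul]
          rw [Finset.sum_comm]
          refine Finset.sum_congr rfl fun _ _ => ?_
          rw [Finset.sum_comm]
          exact Finset.sum_congr rfl fun _ _ => Finset.sum_congr rfl fun _ _ => by ring
      _ = ∑ a, ∑ b, ∑ p, ∑ q, f a i * f b j * (f' p a * f' q b * e (p, q, k)) := by
          simp only [h3', Finset.mul_sum]
      _ = ∑ p, ∑ q, ∑ a, ∑ b, f a i * f b j * (f' p a * f' q b * e (p, q, k)) := by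
          rw [Finset.sum_congr rfl fun a _ => Finset.sum_comm, Finset.sum_comm]
          refine Finset.sum_congr rfl fun p _ => ?_
          rw [Finset.sum_congr rfl fun a _ => Finset.sum_comm, Finset.sum_comm]
      _ = _ := by
          refine Finset.sum_congr rfl fun p _ => Finset.sum_congr rfl fun q _ => ?_
          rw [Matrix.mul_apply, Matrix.mul_apply, Finset.sum_mul_sum, Finset.sum_mul]
          refine Finset.sum_congr rfl fun a _ => ?_
          rw [Finset.sum_mul]
          exact Finset.sum_congr rfl fun b _ => by ring

theorem LieProduct.isIsoMatrix_act (f : (Fin n → R) ≃ₗ[R] (Fin n → R)) (μ : LieProduct R n) :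
    IsIsoMatrix μ.structConst (act f μ).structConst
      (LinearMap.toMatrix' f.symm.toLinearMap) (LinearMap.toMatrix' f.toLinearMap) := by
  rw [isIsoMatrix_iff]
  refine ⟨?_, ?_, fun i j k => ?_⟩
  · rw [← LinearMap.toMatrix'_comp]; simp
  · rw [← LinearMap.toMatrix'_comp]; simp
  · have h : f.symm (μ.bracket (Pi.single i 1) (Pi.single j 1)) k
        = (act f μ).bracket (f.symm (Pi.single i 1)) (f.symm (Pi.single j 1)) k := by
      simp [act]
    rw [bracket_apply] at h
    have h1 : f.symm (μ.bracket (Pi.single i 1) (Pi.single j 1)) k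
        = ∑ l, μ.structConst (i, j, l) * f.symm (Pi.single l 1) k := by
      conv_lhs => rw [← (Pi.basisFun R (Fin n)).sum_repr (μ.bracket _ _)]
      simp [structConst]
    rw [h1] at h
    simpa [LinearMap.toMatrix'_apply] using h

end IsoMatrix

/-! ### Uniformly bounded isomorphisms near a rigid algebra. -/

section Compactness

variable {n : ℕ}

theorem continuous_lieRel (r) :
    Continuous fun c : Fin n × Fin n × Fin n → ℂ => lieRel r c := by
  rcases r with ⟨i, k⟩ | ⟨i, j, k⟩ | ⟨i, j, k, m⟩ <;> simp only [lieRel] <;> fun_prop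

theorem isClosed_isLieSC : IsClosed {c : Fin n × Fin n × Fin n → ℂ | IsLieSC c} := by
  simp only [IsLieSC, Set.ofPred_forall]
  exact isClosed_iInter fun r => isClosed_eq (continuous_lieRel r) continuous_const

/-- The structure constants which are isomorphic to `d` by a matrix bounded by `r`, with inverse
bounded by `r`. -/
def boundedOrbit (d : Fin n × Fin n × Fin n → ℂ) (r : ℝ) : Set (Fin n × Fin n × Fin n → ℂ) :=
  {c | ∃ f g : Matrix (Fin n) (Fin n) ℂ, IsIsoMatrix c d f g ∧ (∀ i j, ‖f i j‖ ≤ r) ∧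
    ∀ i j, ‖g i j‖ ≤ r}

theorem continuous_isoRel {X : Type*} [TopologicalSpace X] {c : X → Fin n × Fin n × Fin n → ℂ}
    {f g : X → Matrix (Fin n) (Fin n) ℂ} (d : Fin n × Fin n × Fin n → ℂ) (hc : Continuous c)
    (hf : ∀ i j, Continuous fun x => f x i j) (hg : ∀ i j, Continuous fun x => g x i j) (r) :
    Continuous fun x => isoRel (c x) d (f x) (g x) r := by
  rcases r with ⟨i, j⟩ | ⟨i, j⟩ | ⟨i, j, k⟩
  · simp only [isoRel, Matrix.sub_apply, Matrix.mul_apply]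
    exact (continuous_finsetSum _ fun k _ => (hf i k).mul (hg k j)).sub continuous_const
  · simp only [isoRel, Matrix.sub_apply, Matrix.mul_apply]
    exact (continuous_finsetSum _ fun k _ => (hg i k).mul (hf k j)).sub continuous_const
  · exact (continuous_finsetSum _ fun l _ => ((continuous_apply _).comp hc).mul (hf k l)).sub
      (continuous_finsetSum _ fun a _ => continuous_finsetSum _ fun b _ =>
        ((hf a i).mul (hf b j)).mul continuous_const)

/-- The bounds confine f and g to a compact box, and projecting a closed set along a compact factor
gives a closed set. -/
theorem isClosed_boundedOrbit (d : Fin n × Fin n × Fin n → ℂ) (r : ℝ) :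
    IsClosed (boundedOrbit d r) := by
  let Box := (Set.univ.pi fun _ : Fin n => Set.univ.pi fun _ : Fin n => Metric.closedBall (0 : ℂ) r)
  have hBox : IsCompact Box := isCompact_univ_pi fun _ => isCompact_univ_pi fun _ =>
    isCompact_closedBall _ _
  have : CompactSpace Box := isCompact_iff_compactSpace.1 hBox
  have hZ : IsClosed {z : (Fin n × Fin n × Fin n → ℂ) × (Box × Box) |
      IsIsoMatrix z.1 d (Matrix.of z.2.1.1) (Matrix.of z.2.2.1)} := by
    simp only [IsIsoMatrix, Set.ofPred_forall]
    refine isClosed_iInter fun r => isClosed_eq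
      (continuous_isoRel d continuous_fst (fun i j => ?_) (fun i j => ?_) r) continuous_const
    · exact (continuous_apply_apply i j).comp
        (continuous_subtype_val.comp (continuous_fst.comp continuous_snd))
    · exact (continuous_apply_apply i j).comp
        (continuous_subtype_val.comp (continuous_snd.comp continuous_snd))
  convert isClosedMap_fst_of_compactSpace _ hZ using 1
  ext c
  constructor
  · rintro ⟨f, g, h, hf, hg⟩
    exact ⟨(c, ⟨f, fun i _ j _ => mem_closedBall_zero_iff.2 (hf i j)⟩,
      ⟨g, fun i _ j _ => mem_closedBall_zero_iff.2 (hg i j)⟩), h, rfl⟩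
  · rintro ⟨⟨c, f, g⟩, h, rfl⟩
    exact ⟨Matrix.of f.1, Matrix.of g.1, h,
      fun i j => mem_closedBall_zero_iff.1 (f.2 i trivial j trivial),
      fun i j => mem_closedBall_zero_iff.1 (g.2 i trivial j trivial)⟩

namespace LieProduct

open Topology

/-- By the Baire category theorem, an orbit which is Zariski open contains, for some bound, a
relatively open set of Lie algebras isomorphic to `μ` by matrices satisfying this bound. -/
theorem exists_open_subset_boundedOrbit {μ : LieProduct ℂ n} (hμ : μ.IsRigid) :
    ∃ (f : (Fin n → ℂ) ≃ₗ[ℂ] (Fin n → ℂ)) (r : ℝ), ∀ᶠ c in 𝓝 (act f μ).structConst,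
      IsLieSC c → c ∈ boundedOrbit μ.structConst r := by
  obtain ⟨S, hS⟩ := hμ
  obtain ⟨p, hpS, hp⟩ : μ ∈ {lam : LieProduct ℂ n |
      ∃ p ∈ S, MvPolynomial.eval lam.structConst p ≠ 0} := by
    rw [← hS]
    exact mem_orbit_iff.2 (IsoSC.refl _)
  have horb : ∀ lam : LieProduct ℂ n, MvPolynomial.eval lam.structConst p ≠ 0 → lam ∈ μ.orbit :=
    fun lam h => hS ▸ ⟨p, hpS, h⟩
  have hopen : IsOpen {c : Fin n × Fin n × Fin n → ℂ | MvPolynomial.eval c p ≠ 0} :=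
    isOpen_ne_fun (MvPolynomial.continuous_eval p) continuous_const
  let O : Set (Fin n × Fin n × Fin n → ℂ) := {c | IsLieSC c} ∩ {c | MvPolynomial.eval c p ≠ 0}
  have hO : IsLocallyClosed O := isClosed_isLieSC.isLocallyClosed.inter hopen.isLocallyClosed
  -- This makes O a Baire space, so one of the countably many closed sets covering it has an
  -- interior point c. That point is in the orbit but need not be μ.
  have : LocallyCompactSpace O := hO.locallyCompactSpace
  have : Nonempty O := ⟨⟨μ.structConst, μ.isLieSC_structConst, hp⟩⟩
  have hcov : ⋃ r : ℕ, ((↑) ⁻¹' boundedOrbit μ.structConst r : Set O) = Set.univ := by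
    refine Set.eq_univ_of_forall fun c => Set.mem_iUnion.2 ?_
    have h1 := horb (ofStructConst c.1 c.2.1) (by rw [structConst_ofStructConst]; exact c.2.2)
    rw [mem_orbit_iff, structConst_ofStructConst] at h1
    obtain ⟨f, g, h⟩ := h1
    obtain ⟨r, hr⟩ := exists_nat_ge (∑ i, ∑ j, (‖f i j‖ + ‖g i j‖))
    have hle : ∀ i j, ‖f i j‖ + ‖g i j‖ ≤ r := fun i j =>
      ((Finset.single_le_sum (f := fun j => ‖f i j‖ + ‖g i j‖) (fun _ _ => by positivity)
        (Finset.mem_univ j)).trans (Finset.single_le_sum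
          (f := fun i => ∑ j, (‖f i j‖ + ‖g i j‖)) (fun _ _ => by positivity)
            (Finset.mem_univ i))).trans hr
    exact ⟨r, f, g, isIsoMatrix_iff.2 h, fun i j => by linarith [hle i j, norm_nonneg (g i j)],
      fun i j => by linarith [hle i j, norm_nonneg (f i j)]⟩
  obtain ⟨r, c, hc⟩ := nonempty_interior_of_iUnion_of_closed
    (fun r : ℕ => (isClosed_boundedOrbit μ.structConst r).preimage continuous_subtype_val) hcov
  have hcO := horb (ofStructConst c.1 c.2.1) (by rw [structConst_ofStructConst]; exact c.2.2)
  obtain ⟨f, hf⟩ := hcO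
  refine ⟨f, r, ?_⟩
  have hfc : (act f μ).structConst = c := by
    rw [← structConst_ofStructConst c.1 c.2.1, ← hf]
  rw [hfc]
  rw [mem_interior_iff_mem_nhds, mem_nhds_subtype_iff_nhdsWithin,
    mem_nhdsWithin_iff_eventually] at hc
  filter_upwards [hc, hopen.mem_nhds c.2.2] with x hx hxp hxL
  obtain ⟨y, hy, rfl⟩ := hx ⟨hxL, hxp⟩
  exact hy

/-- The Lie algebras which are sufficiently close to a rigid Lie algebra are isomorphic to it by
uniformly bounded matrices. -/
theorem eventually_mem_boundedOrbit {μ : LieProduct ℂ n} (hμ : μ.IsRigid) :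
    ∃ r : ℝ, ∀ᶠ c in 𝓝 μ.structConst, IsLieSC c → c ∈ boundedOrbit μ.structConst r := by
  obtain ⟨f, r, h⟩ := exists_open_subset_boundedOrbit hμ
  let T : (Fin n × Fin n × Fin n → ℂ) → Fin n × Fin n × Fin n → ℂ := fun c s =>
    ∑ l, (∑ a, ∑ b, f (Pi.single s.1 1) a * f (Pi.single s.2.1 1) b * c (a, b, l)) *
      f.symm (Pi.single l 1) s.2.2
  have hT : Continuous T := by fun_prop
  have hTact : ∀ lam : LieProduct ℂ n, T lam.structConst = (act f lam).structConst := fun lam =>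
    funext fun s => (structConst_act f lam s.1 s.2.1 s.2.2).symm
  let A := LinearMap.toMatrix' f.symm.toLinearMap
  let B := LinearMap.toMatrix' f.toLinearMap
  -- A Lie law c near μ is first moved by f to one near f * μ, and then to μ by F and G. The
  -- composite is F A with inverse B G, and this sum dominates all entries of both.
  refine ⟨∑ i, ∑ j, ∑ k, (r * ‖A k j‖ + ‖B i k‖ * r), ?_⟩
  rw [← hTact] at h
  filter_upwards [hT.continuousAt.eventually h] with c hc hcL
  have hcs := structConst_ofStructConst c hcL
  rw [← hcs, hTact] at hc
  obtain ⟨F, G, hFG, hF, hG⟩ := hc (isLieSC_structConst _)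
  have hcomp := (isIsoMatrix_act f (ofStructConst c hcL)).trans hFG
  rw [hcs] at hcomp
  have hr : ∀ i : Fin n, 0 ≤ r := fun i => (norm_nonneg _).trans (hF i i)
  have hnn : ∀ i j k : Fin n, 0 ≤ r * ‖A k j‖ + ‖B i k‖ * r := fun i j k => by
    have := hr i
    positivity
  have hle : ∀ i j, ∑ k, (r * ‖A k j‖ + ‖B i k‖ * r) ≤
      ∑ i, ∑ j, ∑ k, (r * ‖A k j‖ + ‖B i k‖ * r) := fun i j =>
    (Finset.single_le_sum (f := fun j => ∑ k, (r * ‖A k j‖ + ‖B i k‖ * r))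
      (fun j _ => Finset.sum_nonneg fun k _ => hnn i j k) (Finset.mem_univ j)).trans
    (Finset.single_le_sum (f := fun i => ∑ j, ∑ k, (r * ‖A k j‖ + ‖B i k‖ * r))
      (fun i _ => Finset.sum_nonneg fun j _ => Finset.sum_nonneg fun k _ => hnn i j k)
      (Finset.mem_univ i))
  refine ⟨F * A, B * G, hcomp, fun i j => le_trans ?_ (hle i j), fun i j => le_trans ?_ (hle i j)⟩
  · rw [Matrix.mul_apply]
    refine norm_sum_le_of_le _ fun k _ => ?_
    rw [norm_mul]
    have := mul_le_mul_of_nonneg_right (hF i k) (norm_nonneg (A k j))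
    have := mul_nonneg (norm_nonneg (B i k)) (hr i)
    linarith
  · rw [Matrix.mul_apply]
    refine norm_sum_le_of_le _ fun k _ => ?_
    rw [norm_mul]
    have := mul_le_mul_of_nonneg_left (hG k j) (norm_nonneg (B i k))
    have := mul_nonneg (hr i) (norm_nonneg (A k j))
    linarith

end LieProduct

end Compactness

/-! ### Perturbations of rigid algebras, deformations of non-rigid ones. -/

theorem lieRel_apply {n : ℕ} {X : Type*} (r) (c : Fin n × Fin n × Fin n → X → ℂ) (v : X) :
    lieRel r c v = lieRel r (fun p => c p v) :=
  map_lieRel (Pi.evalRingHom (fun _ : X => ℂ) v) r c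

theorem isoRel_apply {n : ℕ} {X : Type*} (c d : Fin n × Fin n × Fin n → X → ℂ)
    (f g : Matrix (Fin n) (Fin n) (X → ℂ)) (r) (v : X) :
    isoRel c d f g r v = isoRel (fun p => c p v) (fun p => d p v) (Matrix.of fun i j => f i j v)
      (Matrix.of fun i j => g i j v) r :=
  map_isoRel (Pi.evalRingHom (fun _ : X => ℂ) v) c d f g r

namespace LieProduct

variable {n : ℕ}

section Robinson

open RobinsonExtension

variable {F : Type*} [Field F] [Algebra ℂ F] [RobinsonExtension F]

theorem isPerturbation_iff {μ : LieProduct ℂ n} {ν : LieProduct (limited F) n} :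
    μ.IsPerturbation ν ↔ ∀ p, ν.structConst p - algebraMap ℂ (limited F) (μ.structConst p)
      ∈ IsLocalRing.maximalIdeal (limited F) := by
  constructor
  · intro h p
    have hs : ∀ i : Fin n, (fun j => algebraMap ℂ (limited F) ((Pi.single i 1 : Fin n → ℂ) j))
        = Pi.single i 1 := fun i => funext fun j => by
      rcases eq_or_ne j i with rfl | hj
      · simp
      · simp [hj]
    have h1 := h (Pi.single p.1 1) (Pi.single p.2.1 1) p.2.2
    rw [hs, hs] at h1
    exact h1
  · intro h X Y k
    rw [bracket_apply, bracket_apply, map_sum, ← Finset.sum_sub_distrib]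
    refine Ideal.sum_mem _ fun i _ => ?_
    rw [map_sum, ← Finset.sum_sub_distrib]
    refine Ideal.sum_mem _ fun j _ => ?_
    rw [map_mul, map_mul, ← mul_sub]
    exact Ideal.mul_mem_left _ _ (h _)

/-- The perturbations of a rigid Lie algebra are isomorphic to it over the ring of limited
elements. -/
theorem isoSC_of_isPerturbation {μ : LieProduct ℂ n} (hμ : μ.IsRigid)
    {ν : LieProduct (limited F) n} (hν : μ.IsPerturbation ν) :
    IsoSC ν.structConst (algebraMap ℂ (limited F) ∘ μ.structConst) := by
  rw [isPerturbation_iff] at hν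
  obtain ⟨r, hr⟩ := eventually_mem_boundedOrbit hμ
  obtain ⟨δ, hδ, hball⟩ := Metric.eventually_nhds_iff.1 hr
  -- The matrices must be functions defined on all of ℂ^(n³) for transfer to apply. Elsewhere they
  -- are zero, whence the bound `max r 0`.
  have hgood : ∀ c : Fin n × Fin n × Fin n → ℂ, ∃ f g : Matrix (Fin n) (Fin n) ℂ,
      (IsLieSC c → (∀ p, ‖c p - μ.structConst p‖ ≤ δ / 2) →
        IsIsoMatrix c μ.structConst f g) ∧ (∀ i j, ‖f i j‖ ≤ max r 0) ∧
        ∀ i j, ‖g i j‖ ≤ max r 0 := fun c => by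
    by_cases h : IsLieSC c ∧ ∀ p, ‖c p - μ.structConst p‖ ≤ δ / 2
    · have hd : dist c μ.structConst < δ := by
        refine lt_of_le_of_lt ((dist_pi_le_iff (by positivity)).2 fun p => ?_) (half_lt_self hδ)
        rw [dist_eq_norm]
        exact h.2 p
      obtain ⟨f, g, h1, h2, h3⟩ := hball hd h.1
      exact ⟨f, g, fun _ _ => h1, fun i j => (h2 i j).trans (le_max_left _ _),
        fun i j => (h3 i j).trans (le_max_left _ _)⟩
    · exact ⟨0, 0, fun h1 h2 => absurd ⟨h1, h2⟩ h, by simp, by simp⟩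
  choose f g hfg hf hg using hgood
  obtain ⟨φ, hφ1, hφ2, hφ3⟩ := exists_starEvalHom (F := F) (fun p => (ν.structConst p : F))
  let x : Fin n × Fin n × Fin n → (Fin n × Fin n × Fin n → ℂ) → ℂ := fun p v => v p
  let d : Fin n × Fin n × Fin n → (Fin n × Fin n × Fin n → ℂ) → ℂ := fun p _ => μ.structConst p
  let M : Matrix (Fin n) (Fin n) ((Fin n × Fin n × Fin n → ℂ) → ℂ) :=
    Matrix.of fun i j v => f v i j
  let N : Matrix (Fin n) (Fin n) ((Fin n × Fin n × Fin n → ℂ) → ℂ) :=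
    Matrix.of fun i j v => g v i j
  have hx : φ.toRingHom ∘ x = (limited F).subtype ∘ ν.structConst := funext hφ1
  have hd : φ.toRingHom ∘ d = (limited F).subtype ∘ algebraMap ℂ (limited F) ∘ μ.structConst :=
    funext fun p => φ.commutes (μ.structConst p)
  -- The Lie relations and the cut-off functions 0/1 of the δ/2-ball vanish at ν, the latter since ν
  -- − μ is infinitesimal. The isomorphism equations vanish wherever all of these do, so they hold
  -- at ν.
  have hker : ∀ s, isoRel x d M N s ∈ RingHom.ker φ.toRingHom := fun s => by
    refine mem_ideal_of_forall_zero (h := Sum.elim (fun t => lieRel t x)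
      (fun p v => if ‖v p - μ.structConst p‖ ≤ δ / 2 then 0 else 1)) ?_ fun v hv => ?_
    · rintro (t | p)
      · rw [Sum.elim_inl, RingHom.mem_ker, map_lieRel, hx, ← map_lieRel, ν.isLieSC_structConst,
          map_zero]
      · refine hφ3 (fun v => v p - μ.structConst p) _ (δ / 2) (fun v hv => if_pos hv) ?_
        have h1 : φ (fun v => v p - μ.structConst p) =
            ((ν.structConst p - algebraMap ℂ (limited F) (μ.structConst p) : limited F) : F) :=
          (map_sub φ (x p) (d p)).trans (congrArg₂ (· - ·) (congrFun hx p) (congrFun hd p))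
        rw [h1]
        exact boundedBy_of_mem_maximalIdeal (hν p) (half_pos hδ)
    · have h1 : IsLieSC v := fun t => (lieRel_apply t x v).symm.trans (hv (.inl t))
      have h2 : ∀ p, ‖v p - μ.structConst p‖ ≤ δ / 2 := fun p => by
        by_contra hp
        have := hv (.inr p)
        rw [Sum.elim_inr, if_neg hp] at this
        exact one_ne_zero this
      exact (isoRel_apply x d M N s v).trans (hfg v h1 h2 s)
  let M' : Matrix (Fin n) (Fin n) (limited F) :=
    Matrix.of fun i j => ⟨φ (M i j), _, hφ2 (M i j) _ fun v => hf v i j⟩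
  let N' : Matrix (Fin n) (Fin n) (limited F) :=
    Matrix.of fun i j => ⟨φ (N i j), _, hφ2 (N i j) _ fun v => hg v i j⟩
  have hiso : IsIsoMatrix ν.structConst (algebraMap ℂ (limited F) ∘ μ.structConst) M' N' :=
    fun s => Subtype.ext (by
      have h1 := hker s
      rw [RingHom.mem_ker, map_isoRel, hx, hd] at h1
      exact (map_isoRel (limited F).subtype _ _ M' N' s).trans h1)
  exact hiso.isoSC

end Robinson

/-- A Lie algebra which is not rigid has a deformation, over every suitable ring, which is not
isomorphic to it over any algebraically closed field. -/
theorem exists_deformation_not_isoSC {μ : LieProduct ℂ n} (hμ : ¬ μ.IsRigid) {B K : Type*}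
    [CommRing B] [IsDomain B] [Algebra ℂ B] [Field K] [IsAlgClosed K] [Algebra B K]
    [FaithfulSMul B K] [IsIntegrallyClosedIn B K] {J : Ideal B} [J.IsPrime] {t : B} (ht : t ∈ J)
    (ht0 : t ≠ 0) :
    ∃ ν : LieProduct B n, (∀ p, ν.structConst p - algebraMap ℂ B (μ.structConst p) ∈ J) ∧
      ∀ (E : Type u) [Field E] [IsAlgClosed E] [Algebra ℂ E] (θ : B →ₐ[ℂ] E),
        Function.Injective θ → ¬ IsoSC (θ ∘ ν.structConst) (algebraMap ℂ E ∘ μ.structConst) := by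
  obtain ⟨y, q, hyμ, hq, hy⟩ := exists_generic_nonorbit hμ
  let e : (MvPolynomial (Fin n × Fin n × Fin n) ℂ ⧸ y.asIdeal) →ₐ[ℂ] ℂ :=
    Ideal.Quotient.liftₐ _ (MvPolynomial.aeval μ.structConst) fun a ha => hyμ ha
  obtain ⟨ψ, hψ, hψq⟩ := exists_algHom_specialization (K := K) e
    (q := Ideal.Quotient.mk y.asIdeal q) (fun h => hq (Ideal.Quotient.eq_zero_iff_mem.1 h)) ht ht0
  let ψ' : MvPolynomial (Fin n × Fin n × Fin n) ℂ →ₐ[ℂ] B :=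
    ψ.comp (Ideal.Quotient.mkₐ ℂ y.asIdeal)
  have hψ' : ∀ p ∈ y.asIdeal, ψ' p = 0 := fun p hp =>
    (congrArg ψ (Ideal.Quotient.eq_zero_iff_mem.2 hp)).trans (map_zero ψ)
  have hLie : IsLieSC (ψ' ∘ MvPolynomial.X) := fun r => by
    refine (map_lieRel ψ'.toRingHom r MvPolynomial.X).symm.trans (hψ' _ ?_)
    exact (hy y le_rfl hq).1 (Set.mem_range_self r)
  refine ⟨ofStructConst _ hLie, fun p => ?_, fun E _ _ _ θ hθ hiso => ?_⟩
  · rw [structConst_ofStructConst]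
    have h1 := hψ (Ideal.Quotient.mk y.asIdeal (MvPolynomial.X p))
    have h2 : e (Ideal.Quotient.mk y.asIdeal (MvPolynomial.X p)) = μ.structConst p :=
      MvPolynomial.aeval_X _ _
    rw [h2] at h1
    exact h1
  · rw [structConst_ofStructConst] at hiso
    have h3 : ∀ p, MvPolynomial.aeval (θ ∘ ψ' ∘ MvPolynomial.X) p
        = θ (ψ' p) := fun p => by
      have h4 : MvPolynomial.aeval (θ ∘ ψ' ∘ MvPolynomial.X)
          = θ.comp ψ' := MvPolynomial.algHom_ext fun i => by simp
      rw [h4]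
      rfl
    -- The prime of θ ∘ ψ' contains y, and it omits q because θ is injective and ψ q ≠ 0; it thus
    -- lies outside the orbit.
    refine (hy (kerPoint (θ ∘ ψ' ∘ MvPolynomial.X)) (fun p hp => ?_)
      (fun hq' => hψq ?_)).2 (kerPoint_mem_isoLocus.2 hiso)
    · rw [mem_kerPoint, h3, hψ' p hp, map_zero]
    · rw [mem_kerPoint, h3] at hq'
      exact hθ (hq'.trans (map_zero _).symm)

end LieProduct

/-! ### A deformation ring in the algebraic closure of ℂ(X). -/

section ValuationRing

open Polynomial

/-- There is a deformation ring, with augmentation which is not injective, whose fraction field is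
algebraically closed. -/
theorem exists_deformationRing : ∃ (B : Type) (_ : CommRing B) (_ : IsDomain B)
    (_ : ValuationRing B) (_ : Algebra ℂ B) (ε : B →ₐ[ℂ] ℂ) (K : Type) (_ : Field K)
    (_ : IsAlgClosed K) (_ : Algebra B K) (_ : FaithfulSMul B K) (_ : IsIntegrallyClosedIn B K),
    ∃ t : B, t ≠ 0 ∧ ε t = 0 := by
  let K := AlgebraicClosure (RatFunc ℂ)
  let i : ℂ[X] →+* K := algebraMap ℂ[X] K
  have hi : Function.Injective i := by
    change Function.Injective (algebraMap ℂ[X] K)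
    rw [IsScalarTower.algebraMap_eq ℂ[X] (RatFunc ℂ) K]
    exact (algebraMap (RatFunc ℂ) K).injective.comp (IsFractionRing.injective ℂ[X] (RatFunc ℂ))
  have hXA : i X ∈ i.range := ⟨X, rfl⟩
  -- A valuation ring of K containing ℂ[X] with X a non-unit.
  obtain ⟨B, hAB, hB⟩ := Ideal.image_subset_nonunits_valuationSubring (K := K) (A := i.range)
    (Ideal.span {⟨i X, hXA⟩}) (by
      rw [Ne, Ideal.span_singleton_eq_top]
      intro hu
      obtain ⟨⟨_, p, rfl⟩, hp⟩ := hu.exists_right_inv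
      have h1 : i (X * p) = i 1 := by
        rw [map_mul, map_one]
        exact congrArg Subtype.val hp
      exact not_isUnit_X (IsUnit.of_mul_eq_one _ (hi h1)))
  let j : ℂ[X] →+* B := i.codRestrict B.toSubring fun p => hAB ⟨p, rfl⟩
  have hXm : j X ∈ IsLocalRing.maximalIdeal B := by
    have h1 : i X ∈ B.nonunits := hB ⟨⟨i X, hXA⟩, Ideal.mem_span_singleton_self _, rfl⟩
    exact B.coe_mem_nonunits_iff.1 h1
  let : Algebra ℂ B := (j.comp C).toAlgebra
  -- The residue field is algebraic over ℂ: an element of B is a root of a primitive polynomial over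
  -- ℂ[X], whose coefficients are not all divisible by X, so its reduction at X = 0 is a nonzero
  -- polynomial over ℂ.
  have hint : Algebra.IsIntegral ℂ (IsLocalRing.ResidueField B) := by
    refine ⟨fun x => ?_⟩
    obtain ⟨x, rfl⟩ := IsLocalRing.residue_surjective x
    have : Algebra.IsAlgebraic ℂ[X] (RatFunc ℂ) :=
      IsLocalization.isAlgebraic _ (nonZeroDivisors ℂ[X])
    have halg : Algebra.IsAlgebraic ℂ[X] K := .trans ℂ[X] (RatFunc ℂ) K
    obtain ⟨Q, hQ0, hQ⟩ := halg.isAlgebraic (x : K)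
    have h1 : Q.primPart.eval₂ i (x : K) = 0 := by
      rw [Q.eq_C_content_mul_primPart, map_mul, aeval_C] at hQ
      exact (mul_eq_zero.1 hQ).resolve_left fun h =>
        hQ0 (content_eq_zero_iff.1 (hi (h.trans (map_zero i).symm)))
    have h2 : Q.primPart.eval₂ j x = 0 := Subtype.ext (by
      have := hom_eval₂ Q.primPart j B.subtype x
      exact this.trans h1)
    have h3 : (IsLocalRing.residue B).comp j =
        (algebraMap ℂ (IsLocalRing.ResidueField B)).comp (evalRingHom 0) := by
      refine Polynomial.ringHom_ext (fun a => ?_) ?_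
      · simp only [RingHom.comp_apply, coe_evalRingHom, eval_C]
        rfl
      · simp only [RingHom.comp_apply, coe_evalRingHom, eval_X, map_zero]
        exact (IsLocalRing.residue_eq_zero_iff _).2 hXm
    have h4 := hom_eval₂ Q.primPart j (IsLocalRing.residue B) x
    rw [h2, map_zero, h3, ← eval₂_map] at h4
    have h5 : Q.primPart.map (evalRingHom (0 : ℂ)) ≠ 0 := fun h0 => by
      refine not_isUnit_X (Q.isPrimitive_primPart X ((C_dvd_iff_dvd_coeff _ _).2 fun k => ?_))
      rw [X_dvd_iff, coeff_zero_eq_eval_zero]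
      have := congrArg (fun p => coeff p k) h0
      simpa using this
    exact isAlgebraic_iff_isIntegral.1 ⟨_, h5, h4.symm⟩
  let ε₀ : ℂ ≃ₐ[ℂ] IsLocalRing.ResidueField B := AlgEquiv.ofBijective (Algebra.ofId _ _)
    IsAlgClosed.algebraMap_bijective_of_isIntegral
  refine ⟨B, inferInstance, inferInstance, inferInstance, inferInstance,
    (ε₀.symm : _ →ₐ[ℂ] ℂ).comp (IsScalarTower.toAlgHom ℂ B (IsLocalRing.ResidueField B)), K,
    inferInstance, inferInstance, inferInstance, inferInstance, ?_, j X, fun h0 => ?_, ?_⟩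
  · exact (isIntegrallyClosed_iff_isIntegrallyClosedIn K).1 inferInstance
  · exact X_ne_zero (hi ((congrArg Subtype.val h0).trans (map_zero i).symm))
  · change ε₀.symm (IsLocalRing.residue B (j X)) = 0
    rw [(IsLocalRing.residue_eq_zero_iff _).2 hXm, map_zero]

end ValuationRing

/-! ### Transport of Lie algebras to arbitrary universes. -/

section ULift

variable {R : Type*} [CommRing R]

instance {L : Type*} [LieRing L] : LieRing (ULift.{w} L) where
  bracket x y := ⟨⁅x.down, y.down⁆⟩
  add_lie x y z := ULift.ext _ _ (add_lie x.down y.down z.down)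
  lie_add x y z := ULift.ext _ _ (lie_add x.down y.down z.down)
  lie_self x := ULift.ext _ _ (lie_self x.down)
  leibniz_lie x y z := ULift.ext _ _ (leibniz_lie x.down y.down z.down)

instance {L : Type*} [LieRing L] [LieAlgebra R L] : LieAlgebra (ULift.{v} R) (ULift.{w} L) where
  lie_smul t x y := ULift.ext _ _ (lie_smul t.down x.down y.down)

namespace LieProduct

variable {n : ℕ}

/-- The standard basis of the lift of `(R^n, ν)` to other universes. -/
noncomputable def uliftBasis (ν : LieProduct R n) :
    Module.Basis (Fin n) (ULift.{v} R) (ULift.{w} ν.Alg) :=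
  .ofEquivFun
    { toFun := fun x i => ⟨ν.stdBasis.equivFun x.down i⟩
      map_add' := fun x y => funext fun i => ULift.ext _ _
        (congrFun (map_add ν.stdBasis.equivFun x.down y.down) i)
      map_smul' := fun t x => funext fun i => ULift.ext _ _
        (congrFun (map_smul ν.stdBasis.equivFun t.down x.down) i)
      invFun := fun f => ⟨ν.stdBasis.equivFun.symm fun i => (f i).down⟩
      left_inv := fun x => ULift.ext _ _ (ν.stdBasis.equivFun.symm_apply_apply x.down)
      right_inv := fun f => funext fun i => ULift.ext _ _
        (congrFun (ν.stdBasis.equivFun.apply_symm_apply fun i => (f i).down) i) }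

theorem down_uliftBasis (ν : LieProduct R n) (i : Fin n) :
    (uliftBasis.{v, w} ν i).down = ν.stdBasis i := by
  rw [uliftBasis, Module.Basis.coe_ofEquivFun]
  change ν.stdBasis.equivFun.symm _ = _
  rw [LinearEquiv.symm_apply_eq]
  funext j
  rw [Module.Basis.equivFun_self]
  rcases eq_or_ne j i with rfl | hj
  · simp
  · simp [hj, hj.symm]

theorem basisSC_uliftBasis (ν : LieProduct R n) (p) :
    (basisSC (uliftBasis.{v, w} ν) p).down = ν.structConst p := by
  rw [← basisSC_stdBasis]
  change ν.stdBasis.equivFun ⁅(uliftBasis.{v, w} ν p.1).down,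
    (uliftBasis.{v, w} ν p.2.1).down⁆ _ = _
  rw [down_uliftBasis, down_uliftBasis]
  rfl

end LieProduct

end ULift

theorem algebraMap_algebraicClosure_fractionRing_injective (B : Type*) [CommRing B] [IsDomain B] :
    Function.Injective (algebraMap B (AlgebraicClosure (FractionRing B))) := by
  rw [IsScalarTower.algebraMap_eq B (FractionRing B)]
  exact (algebraMap (FractionRing B) (AlgebraicClosure (FractionRing B))).injective.comp
    (IsFractionRing.injective B (FractionRing B))

/-! ### Valued deformations. -/

namespace LieProduct

variable {n : ℕ}

theorem isDeformation_of_basisSC {μ : LieProduct ℂ n} {B : Type*} [CommRing B] [Algebra ℂ B]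
    (ε : B →ₐ[ℂ] ℂ) {h : Type*} [LieRing h] [LieAlgebra B h] (b : Module.Basis (Fin n) B h)
    (hb : ε ∘ basisSC b = μ.structConst) : IsDeformation ε μ.Alg h := by
  let : Algebra B ℂ := ε.toRingHom.toAlgebra
  refine ⟨.of_basis b, lieEquiv_of_isoSC (b.baseChange ℂ) μ.stdBasis ?_⟩
  rw [basisSC_baseChange, basisSC_stdBasis, ← hb]
  exact IsoSC.refl _

/-- The rank is forced: a basis of h over B becomes, along ε and the isomorphism with μ, a complex
basis of an n-dimensional space. -/
theorem exists_basis_of_isDeformation {μ : LieProduct ℂ n} {B : Type*} [CommRing B] [Algebra ℂ B]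
    {ε : B →ₐ[ℂ] ℂ} {h : Type*} [LieRing h] [LieAlgebra B h] (hdef : IsDeformation ε μ.Alg h) :
    ∃ b : Module.Basis (Fin n) B h, IsoSC (ε ∘ basisSC b) μ.structConst := by
  let : Algebra B ℂ := ε.toRingHom.toAlgebra
  obtain ⟨hfree, ⟨e⟩⟩ := hdef
  have : Nontrivial B := ε.toRingHom.domain_nontrivial
  let b₀ := Module.Free.chooseBasis B h
  let b := b₀.reindex (((b₀.baseChange ℂ).map e.toLinearEquiv).indexEquiv μ.stdBasis)
  refine ⟨b, ?_⟩
  have h1 := isoSC_of_lieEquiv (b.baseChange ℂ) μ.stdBasis e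
  rw [basisSC_baseChange, basisSC_stdBasis] at h1
  exact h1

/-- The valued deformations of a rigid Lie algebra are isomorphic to it over algebraically closed
fields. -/
theorem nonempty_lieEquiv_of_isDeformation {μ : LieProduct ℂ n} (hμ : μ.IsRigid) {B : Type*}
    [CommRing B] [Algebra ℂ B] {ε : B →ₐ[ℂ] ℂ} {h : Type*} [LieRing h] [LieAlgebra B h]
    (hdef : IsDeformation ε μ.Alg h) (E : Type*) [Field E] [IsAlgClosed E] [Algebra ℂ E]
    [Algebra B E] [IsScalarTower ℂ B E] [FaithfulSMul B E] :
    Nonempty ((E ⊗[B] h) ≃ₗ⁅E⁆ (E ⊗[ℂ] μ.Alg)) := by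
  obtain ⟨b, hb⟩ := exists_basis_of_isDeformation hdef
  refine lieEquiv_of_isoSC (b.baseChange E) (μ.stdBasis.baseChange E) ?_
  rw [basisSC_baseChange, basisSC_baseChange, basisSC_stdBasis]
  have hL : IsLieSC (ε ∘ basisSC b) := (basisSC_isLieSC b).map ε.toRingHom
  have horb : ofStructConst _ hL ∈ μ.orbit := by
    rwa [mem_orbit_iff, structConst_ofStructConst]
  obtain ⟨S, hS⟩ := hμ
  -- The polynomial is taken nonzero at the reduction of h, which is only isomorphic to μ. Since ε
  -- maps the value of p on h to this nonzero number, that value is nonzero in B and in E.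
  obtain ⟨p, hpS, hp⟩ : ofStructConst _ hL ∈
      {lam : LieProduct ℂ n | ∃ p ∈ S, MvPolynomial.eval lam.structConst p ≠ 0} := hS ▸ horb
  refine isoSC_of_aeval_ne_zero (p := p) (fun lam hl => hS ▸ ⟨p, hpS, hl⟩)
    ((basisSC_isLieSC b).map (algebraMap B E)) fun h0 => hp ?_
  have h1 : MvPolynomial.aeval (algebraMap B E ∘ basisSC b) p =
      algebraMap B E (MvPolynomial.aeval (basisSC b) p) :=
    (MvPolynomial.aeval_algebraMap_apply E (basisSC b) p)
  rw [h1] at h0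
  have h2 := FaithfulSMul.algebraMap_injective B E (h0.trans (map_zero _).symm)
  rw [structConst_ofStructConst, ← MvPolynomial.aeval_eq_eval]
  have h3 := MvPolynomial.comp_aeval_apply (basisSC b) ε p
  rw [h2, map_zero] at h3
  exact h3.symm

theorem exists_valuedDeformation_not_lieEquiv {μ : LieProduct ℂ n} (hμ : ¬ μ.IsRigid) :
    ∃ (B : Type v) (_ : CommRing B) (_ : IsDomain B) (_ : ValuationRing B) (_ : Algebra ℂ B)
      (ε : B →ₐ[ℂ] ℂ) (h : Type w) (_ : LieRing h) (_ : LieAlgebra B h), IsDeformation ε μ.Alg h ∧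
      ¬ Nonempty ((AlgebraicClosure (FractionRing B) ⊗[B] h) ≃ₗ⁅AlgebraicClosure (FractionRing B)⁆
          (AlgebraicClosure (FractionRing B) ⊗[ℂ] μ.Alg)) := by
  obtain ⟨B, _, _, _, _, ε, K, _, _, _, _, _, t, ht0, ht⟩ := exists_deformationRing
  have : (RingHom.ker ε).IsPrime := RingHom.ker_isPrime _
  obtain ⟨ν, hν, hE⟩ := exists_deformation_not_isoSC.{v} hμ (K := K) (J := RingHom.ker ε) ht ht0
  have : IsDomain (ULift.{v} B) := MulEquiv.isDomain B (ULift.ringEquiv (R := B)).toMulEquiv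
  have : ValuationRing (ULift.{v} B) :=
    (ULift.ringEquiv (R := B)).symm.surjective.valuationRing
      (ULift.ringEquiv (R := B)).symm.toRingHom
  refine ⟨ULift.{v} B, inferInstance, inferInstance, inferInstance, inferInstance,
    ε.comp (ULift.algEquiv (R := ℂ) (A := B) : ULift.{v} B →ₐ[ℂ] B), ULift.{w} ν.Alg,
    inferInstance, inferInstance, isDeformation_of_basisSC _ (uliftBasis.{v, w} ν) ?_, ?_⟩
  · funext p
    have h1 : ε (ν.structConst p - algebraMap ℂ B (μ.structConst p)) = 0 := hν p
    rw [map_sub, sub_eq_zero, AlgHom.commutes] at h1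
    refine Eq.trans ?_ h1
    rw [← basisSC_uliftBasis.{v, w}]
    rfl
  · let E := AlgebraicClosure (FractionRing (ULift.{v} B))
    let θ : B →ₐ[ℂ] E := (IsScalarTower.toAlgHom ℂ (ULift.{v} B) E).comp
      (ULift.algEquiv (R := ℂ) (A := B)).symm.toAlgHom
    have hθ : Function.Injective θ := (algebraMap_algebraicClosure_fractionRing_injective _).comp
      (ULift.algEquiv (R := ℂ) (A := B)).symm.injective
    rw [nonempty_lieEquiv_iff ((uliftBasis.{v, w} ν).baseChange E) (μ.stdBasis.baseChange E),
      basisSC_baseChange, basisSC_baseChange, basisSC_stdBasis]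
    have h2 : algebraMap (ULift.{v} B) E ∘ basisSC (uliftBasis.{v, w} ν)
        = θ ∘ ν.structConst := funext fun p => by
      rw [Function.comp_apply, Function.comp_apply, ← basisSC_uliftBasis.{v, w}]
      rfl
    rw [h2]
    exact hE E θ hθ

end LieProduct

theorem mainTheorem5 {n : ℕ} (μ : LieProduct ℂ n) :
    -- over every Robinson extension `F = ℂ*`, with valuation ring `A`: every perturbation is
    -- isomorphic to `g = (ℂ^n, μ)` over `F`, and also over `A`
    (∀ (F : Type u) [Field F] [Algebra ℂ F] [RobinsonExtension F],
      (μ.IsRigid ↔ ∀ ν : LieProduct (RobinsonExtension.limited F) n, μ.IsPerturbation ν →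
        Nonempty ((F ⊗[RobinsonExtension.limited F] ν.Alg) ≃ₗ⁅F⁆ (F ⊗[ℂ] μ.Alg))) ∧
      (μ.IsRigid ↔ ∀ ν : LieProduct (RobinsonExtension.limited F) n, μ.IsPerturbation ν →
        Nonempty (ν.Alg ≃ₗ⁅RobinsonExtension.limited F⁆
          ((RobinsonExtension.limited F) ⊗[ℂ] μ.Alg)))) ∧
    -- every valued deformation is isomorphic to `g` over the algebraic closure of the fraction
    -- field of the deformation ring
    (μ.IsRigid ↔
      ∀ (B : Type v) [CommRing B] [IsDomain B] [ValuationRing B] [Algebra ℂ B] (ε : B →ₐ[ℂ] ℂ)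
        (h : Type w) [LieRing h] [LieAlgebra B h], IsDeformation ε μ.Alg h →
        Nonempty ((AlgebraicClosure (FractionRing B) ⊗[B] h) ≃ₗ⁅AlgebraicClosure (FractionRing B)⁆
          (AlgebraicClosure (FractionRing B) ⊗[ℂ] μ.Alg))) := by
  refine ⟨fun F _ _ _ => ?_, fun hμ B _ _ _ _ ε h _ _ hdef => ?_, fun H => ?_⟩
  · let A := RobinsonExtension.limited F
    have hF : ∀ ν : LieProduct A n, Nonempty ((F ⊗[A] ν.Alg) ≃ₗ⁅F⁆ (F ⊗[ℂ] μ.Alg)) ↔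
        IsoSC (algebraMap A F ∘ ν.structConst) (algebraMap ℂ F ∘ μ.structConst) := fun ν => by
      rw [nonempty_lieEquiv_iff (ν.stdBasis.baseChange F) (μ.stdBasis.baseChange F),
        basisSC_baseChange, basisSC_baseChange, LieProduct.basisSC_stdBasis,
        LieProduct.basisSC_stdBasis]
    have hA : ∀ ν : LieProduct A n, Nonempty (ν.Alg ≃ₗ⁅A⁆ (A ⊗[ℂ] μ.Alg)) ↔
        IsoSC ν.structConst (algebraMap ℂ A ∘ μ.structConst) := fun ν => by
      rw [nonempty_lieEquiv_iff ν.stdBasis (μ.stdBasis.baseChange A), basisSC_baseChange,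
        LieProduct.basisSC_stdBasis, LieProduct.basisSC_stdBasis]
    have hAF : ∀ ν : LieProduct A n, IsoSC ν.structConst (algebraMap ℂ A ∘ μ.structConst) →
        IsoSC (algebraMap A F ∘ ν.structConst) (algebraMap ℂ F ∘ μ.structConst) :=
      fun ν h => h.map (algebraMap A F)
    have hrigid : (∀ ν : LieProduct A n, μ.IsPerturbation ν →
        IsoSC (algebraMap A F ∘ ν.structConst) (algebraMap ℂ F ∘ μ.structConst)) → μ.IsRigid := by
      intro H
      by_contra hμ
      have := RobinsonExtension.isAlgClosed (F := F)
      -- The valuation ring A is integrally closed in its fraction field F, itself algebraically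
      -- closed, so the lifting applies with K = F and J the ideal of infinitesimals.
      have : IsIntegrallyClosedIn A F :=
        (isIntegrallyClosed_iff_isIntegrallyClosedIn F).1 inferInstance
      obtain ⟨t, ht, ht0⟩ := RobinsonExtension.exists_mem_maximalIdeal_limited (F := F)
      obtain ⟨ν, hν, hE⟩ := LieProduct.exists_deformation_not_isoSC hμ (K := F) ht ht0
      exact hE F (IsScalarTower.toAlgHom ℂ A F) Subtype.val_injective
        (H ν (LieProduct.isPerturbation_iff.2 hν))
    exact ⟨⟨fun hμ ν hν => (hF ν).2 (hAF ν (LieProduct.isoSC_of_isPerturbation hμ hν)),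
        fun H => hrigid fun ν hν => (hF ν).1 (H ν hν)⟩,
      ⟨fun hμ ν hν => (hA ν).2 (LieProduct.isoSC_of_isPerturbation hμ hν),
        fun H => hrigid fun ν hν => hAF ν ((hA ν).1 (H ν hν))⟩⟩
  · have : FaithfulSMul B (AlgebraicClosure (FractionRing B)) :=
      (faithfulSMul_iff_algebraMap_injective _ _).2
        (algebraMap_algebraicClosure_fractionRing_injective B)
    exact LieProduct.nonempty_lieEquiv_of_isDeformation hμ hdef _
  · by_contra hμ
    obtain ⟨B, _, _, _, _, ε, h, _, _, hdef, hn⟩ :=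
      LieProduct.exists_valuedDeformation_not_lieEquiv.{v, w} hμ
    exact hn (H B ε h hdef)
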